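/- **Setting.** A matching market consists of a finite set $B$ of buyers and a finite set $S$ of sellers, each linearly ordered by IDs, and a bipartite graph $E\subseteq B\times S$. The value of buyer $i$ is drawn from a probability distribution $D^B_i$ on $[0,\infty)$, the cost of seller $j$ from a probability distribution $D^S_j$ on $[0,\infty)$. A valuation profile $(\mathbf b,\mathbf s)$ has $b_i\in\operatorname{supp}D^B_i$ and $s_j\in\operatorname{supp}D^S_j$ for all $i,j$. The gains from trade (GFT) of a matching $N\subseteq E$ on $(\mathbf b,\mathbf s)$ are $\sum_{(i,j)\in N}(b_i-s_j)$. For edge weights $w$, "the maximum-weight matching" is the one picked, among all matchings in $E$ of maximum total weight, by the lexicographic order by IDs: list edges by buyer ID; at the first place where two lists differ, a list that still has an edge beats one that has ended, then the lower buyer ID wins, then the lower seller ID. The first-best $M(\mathbf b,\mathbf s)$ is the maximum-weight matching for the weights $b_i-s_j$. **RVWM.** For a distribution $D$ with CDF $F$ and quantile function $Q(t)=\inf\{x: F(x)\ge t\}$, the ironed virtual value $\tilde\varphi(v)\in[-\infty,\infty)$ is the slope at $F(v)$, made right-continuous in $v$, of the convex hull (greatest convex minorant) of $t\mapsto-(1-t)Q(t)$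 on the unit interval (and $-\infty$ if $(1-t)Q(t)$ is unbounded); the ironed virtual cost $\tilde\tau(x)\in(-\infty,\infty]$ is the slope at $F(x)$, made left-continuous in $x$, of the convex hull of $t\mapsto tQ(t)$. (With a density $f$, the un-ironed slopes are $v-\frac{1-F(v)}{f(v)}$ and $x+\frac{F(x)}{f(x)}$.) Write $\tilde\varphi_i$, $\tilde\tau_j$ for these functions for $D^B_i$, $D^S_j$. With probability $\frac12$ each, the RVWM mechanism of Brustle et al. trades the maximum-weight matching for the weights $\tilde\varphi_i(b_i)-s_j$, or the maximum-weight matching for the weights $b_i-\tilde\tau_j(s_j)$. **Offering Mechanism.** For each $(i,j)\in M(\mathbf b,\mathbf s)$ let $\bar s\in[0,\infty]$ be the minimal bid of buyer $i$ such that any higher bid puts $i$ in the first-best of the market without seller $j$ ($\bar s=\infty$ if there is none), and let $\bar b\ge 0$ be the supremum of the bids of seller $j$ that put $j$ in the first-best of the market without buyer $i$ ($\bar b=0$ if there are none). With probability $\frac12$ each, one of the following is run on $(i,j)$. * Seller offers: seller $j$ offers the lowest price $p$ among those that maximize $(p-s_j)\Pr[X\ge p]$ over $p\le\bar s$, where $X\sim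 D^B_i|_{\ge\bar b}$; $i$ and $j$ trade iff $p\le b_i$. * Buyer offers: buyer $i$ offers the highest price $p$ among those that maximize $(b_i-p)\Pr[Y\le p]$ over $p\ge\bar b$, where $Y\sim D^S_j|_{\le\bar s}$; $i$ and $j$ trade iff $p\ge s_j$. (No trade occurs when the offer does not exist, in particular when the conditioning event is null.) No other pairs trade. **Lemma.** For every valuation profile $(\mathbf b,\mathbf s)$, the GFT of the Offering Mechanism on $(\mathbf b,\mathbf s)$, in expectation over its coin, is at least half of the GFT of the RVWM mechanism on $(\mathbf b,\mathbf s)$, in expectation over its coin. -/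

import Mathlib

open MeasureTheory ProbabilityTheory

/-! ### Matchings and the lexicographic tie-breaking rule

`β` is the finite set of buyers and `σ` the finite set of sellers; their linear orders are the
orders of the IDs.  A trading graph is a finite set `E` of pairs `(buyer, seller)`. -/

/-- `M` is a matching of the bipartite graph `E`. -/
def IsMatchingIn {β σ : Type*} (E M : Finset (β × σ)) : Prop :=
  M ⊆ E ∧ ∀ e ∈ M, ∀ f ∈ M, (e.1 = f.1 ∨ e.2 = f.2) → e = f

/-- The lexicographic order by IDs.  List the edges of `M` and of `M'` by increasing buyer; at the
first place where the lists differ, the list that still has an edge beats the one that has ended,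
then the lower buyer wins, then the lower seller wins.  Equivalently: the smallest edge (by buyer,
then by seller) that lies in exactly one of the two matchings lies in `M`. -/
def RanksHigher {β σ : Type*} [LinearOrder β] [LinearOrder σ] (M M' : Finset (β × σ)) : Prop :=
  ∃ e ∈ M, e ∉ M' ∧ ∀ f, toLex f < toLex e → (f ∈ M ↔ f ∈ M')

/-- `M` is the maximum-weight matching of `E` picked by lexicographic tie-breaking.  Edge weights
are allowed to be `-∞`. -/
def IsChosenMatching {β σ : Type*} [LinearOrder β] [LinearOrder σ]
    (E : Finset (β × σ)) (w : β × σ → EReal) (M : Finset (β × σ)) : Prop :=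
  (IsMatchingIn E M ∧ ∀ M', IsMatchingIn E M' → ∑ e ∈ M', w e ≤ ∑ e ∈ M, w e) ∧
  ∀ M', IsMatchingIn E M' → ∑ e ∈ M', w e = ∑ e ∈ M, w e → M' ≠ M → RanksHigher M M'

theorem ranksHigher_total {β σ : Type*} [LinearOrder β] [LinearOrder σ]
    {A B : Finset (β × σ)} (h : A ≠ B) : RanksHigher A B ∨ RanksHigher B A := by
  classical
  have hne : (symmDiff A B).Nonempty := by
    rw [Finset.nonempty_iff_ne_empty]
    intro h0
    exact h (symmDiff_eq_bot.1 h0)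
  obtain ⟨e, he, hmin⟩ := Finset.exists_min_image (symmDiff A B) (fun f => toLex f) hne
  have key : ∀ f, toLex f < toLex e → (f ∈ A ↔ f ∈ B) := by
    intro f hf
    by_contra hcon
    have hmem : f ∈ symmDiff A B := by
      rw [Finset.mem_symmDiff]
      tauto
    exact absurd (hmin f hmem) (not_le.2 hf)
  rcases Finset.mem_symmDiff.1 he with ⟨h1, h2⟩ | ⟨h1, h2⟩
  · exact Or.inl ⟨e, h1, h2, key⟩
  · exact Or.inr ⟨e, h1, h2, fun f hf => (key f hf).symm⟩

theorem ranksHigher_trans {β σ : Type*} [LinearOrder β] [LinearOrder σ]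
    {A B C : Finset (β × σ)} (h : RanksHigher A B) (h' : RanksHigher B C) : RanksHigher A C := by
  obtain ⟨e, heA, heB, he⟩ := h
  obtain ⟨f, hfB, hfC, hf⟩ := h'
  rcases lt_trichotomy (toLex e) (toLex f) with hlt | heq | hgt
  · exact ⟨e, heA, fun hc => heB ((hf e hlt).2 hc),
      fun g hg => (he g hg).trans (hf g (hg.trans hlt))⟩
  · exact absurd (toLex.injective heq ▸ hfB) heB
  · exact ⟨f, (he f hgt).2 hfB, hfC, fun g hg => (he g (hg.trans hgt)).trans (hf g hg)⟩

theorem ranksHigher_irrefl {β σ : Type*} [LinearOrder β] [LinearOrder σ]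
    (A : Finset (β × σ)) : ¬ RanksHigher A A := fun ⟨_, h, h', _⟩ => h' h

theorem existsUnique_chosenMatching {β σ : Type*} [LinearOrder β] [LinearOrder σ]
    (E : Finset (β × σ)) (w : β × σ → EReal) : ∃! M, IsChosenMatching E w M := by
  classical
  have hS : (E.powerset.filter (IsMatchingIn E)).Nonempty :=
    ⟨∅, by simp [IsMatchingIn]⟩
  have hmem : ∀ M, M ∈ E.powerset.filter (IsMatchingIn E) ↔ IsMatchingIn E M := by
    intro M
    simp only [Finset.mem_filter, Finset.mem_powerset, and_iff_right_iff_imp]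
    exact fun h => h.1
  obtain ⟨M₀, hM₀, hmax⟩ := Finset.exists_max_image _ (fun M => ∑ e ∈ M, w e) hS
  let T : Finset (Finset (β × σ)) :=
    (E.powerset.filter (IsMatchingIn E)).filter (fun M => ∑ e ∈ M, w e = ∑ e ∈ M₀, w e)
  have hwf : ∀ T : Finset (Finset (β × σ)), T.Nonempty →
      ∃ M ∈ T, ∀ M' ∈ T, M' ≠ M → RanksHigher M M' := by
    intro T hT
    induction hT using Finset.Nonempty.cons_induction with
    | singleton a => exact ⟨a, by simp, by simp⟩
    | cons a s ha hs ih =>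
      obtain ⟨M, hM, hbest⟩ := ih
      have hne : a ≠ M := fun h => ha (h ▸ hM)
      rcases ranksHigher_total hne with h | h
      · refine ⟨a, by simp, fun M' hM' hne' => ?_⟩
        rcases Finset.mem_cons.1 hM' with h1 | h1
        · exact absurd h1 hne'
        · by_cases h2 : M' = M
          · exact h2 ▸ h
          · exact ranksHigher_trans h (hbest M' h1 h2)
      · refine ⟨M, by simp [hM], fun M' hM' hne' => ?_⟩
        rcases Finset.mem_cons.1 hM' with h1 | h1
        · exact h1 ▸ h
        · exact hbest M' h1 hne'
  obtain ⟨M, hM, hbest⟩ := hwf T ⟨M₀, Finset.mem_filter.2 ⟨hM₀, rfl⟩⟩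
  have hM1 := Finset.mem_filter.1 hM
  refine ⟨M, ⟨⟨(hmem M).1 hM1.1, fun M' hM' => ?_⟩, fun M' hM' hw hne => ?_⟩, ?_⟩
  · rw [hM1.2]
    exact hmax M' ((hmem M').2 hM')
  · exact hbest M' (Finset.mem_filter.2 ⟨(hmem M').2 hM', hw.trans hM1.2⟩) hne
  · intro N hN
    by_contra hne
    have hw : ∑ e ∈ N, w e = ∑ e ∈ M, w e := by
      apply le_antisymm
      · rw [hM1.2]
        exact hmax N ((hmem N).2 hN.1.1)
      · exact hN.1.2 M ((hmem M).1 hM1.1)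
    have h1 := hN.2 M ((hmem M).1 hM1.1) hw.symm (Ne.symm hne)
    have h2 := hbest N (Finset.mem_filter.2 ⟨(hmem N).2 hN.1.1, hw.trans hM1.2⟩) hne
    exact ranksHigher_irrefl _ (ranksHigher_trans h1 h2)

/-- The maximum-weight matching of `E`, ties broken lexicographically by IDs. -/
noncomputable def chosenMatching {β σ : Type*} [LinearOrder β] [LinearOrder σ]
    (E : Finset (β × σ)) (w : β × σ → EReal) : Finset (β × σ) :=
  (existsUnique_chosenMatching E w).choose

theorem chosenMatching_spec {β σ : Type*} [LinearOrder β] [LinearOrder σ]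
    (E : Finset (β × σ)) (w : β × σ → EReal) : IsChosenMatching E w (chosenMatching E w) :=
  (existsUnique_chosenMatching E w).choose_spec.1

/-- The first-best matching of the market `E` on the profile `(b, s)`. -/
noncomputable def firstBest {β σ : Type*} [LinearOrder β] [LinearOrder σ]
    (E : Finset (β × σ)) (b : β → ℝ) (s : σ → ℝ) : Finset (β × σ) :=
  chosenMatching E (fun e => ((b e.1 - s e.2 : ℝ) : EReal))

/-- The gains from trade on the profile `(b, s)` when exactly the pairs in `M` trade. -/
noncomputable def gainsFromTrade {β σ : Type*} (b : β → ℝ) (s : σ → ℝ) (M : Finset (β × σ)) : ℝ :=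
  ∑ e ∈ M, (b e.1 - s e.2)

/-! ### Ironed virtual values and costs -/

/-- The quantile function of the distribution `D`, for `0 < t < 1`. -/
noncomputable def quantile (D : Measure ℝ) (t : ℝ) : ℝ := sInf {x : ℝ | t ≤ cdf D x}

/-- The affine function `x ↦ a * x + c` lies below `H` on `(0, 1)`. -/
def IsAffineMinorant (H : ℝ → ℝ) (a c : ℝ) : Prop := ∀ x ∈ Set.Ioo (0 : ℝ) 1, a * x + c ≤ H x

/-- The (closed) convex hull of `H` on the unit interval: the supremum of the affine functions that
lie below `H` on `(0, 1)`.  It is used only at points of `[0, 1]`, and where such an affine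
function exists. -/
noncomputable def convexEnvelope (H : ℝ → ℝ) (t : ℝ) : ℝ :=
  sSup {y : ℝ | ∃ a c : ℝ, IsAffineMinorant H a c ∧ y = a * t + c}

/-- Minus the revenue curve in the quantile space of values: selling with probability `1 - t` at
the price `quantile D t`.  For a distribution with CDF `F` and positive density `f`, its derivative
at `t = F v` is the virtual value `v - (1 - F v) / f v`. -/
noncomputable def negRevenueCurve (D : Measure ℝ) (t : ℝ) : ℝ := -((1 - t) * quantile D t)

/-- The procurement-cost curve in the quantile space of costs: buying with probability `t` at the
price `quantile D t`.  For a distribution with CDF `F` and positive density `f`, its derivative at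
`t = F x` is the virtual cost `x + F x / f x`. -/
noncomputable def costCurve (D : Measure ℝ) (t : ℝ) : ℝ := t * quantile D t

open Classical in
/-- Myerson's ironed virtual value of a buyer with value `v` drawn from `D`: the slope at `F v` of
the convex hull of `negRevenueCurve D`, made right-continuous in `v`.  (Slopes of the hull are
nondecreasing, so the limit from the right is an infimum.)  For atoms this gives the usual discrete
formula.  It is `-∞` if the revenue curve is unbounded, as the hull of the negated curve is then
identically `-∞`. -/
noncomputable def ironedVirtualValue (D : Measure ℝ) (v : ℝ) : EReal :=
  if ∃ a c, IsAffineMinorant (negRevenueCurve D) a c then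
    ⨅ w : Set.Ioi v, ((derivWithin (convexEnvelope (negRevenueCurve D))
      (Set.Iio (cdf D (w : ℝ))) (cdf D (w : ℝ)) : ℝ) : EReal)
  else ⊥

/-- The ironed virtual cost of a seller with cost `x` drawn from `D` (the mirror image of
`ironedVirtualValue`): the slope at `F x` of the convex hull of `costCurve D`, made left-continuous
in `x`. -/
noncomputable def ironedVirtualCost (D : Measure ℝ) (x : ℝ) : EReal :=
  ⨆ w : Set.Iio x, ((derivWithin (convexEnvelope (costCurve D))
    (Set.Ioi (cdf D (w : ℝ))) (cdf D (w : ℝ)) : ℝ) : EReal)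

/-! ### The Random Virtual-Welfare Maximizing mechanism -/

/-- The pairs that trade in the Generalized Seller-Offering Mechanism. -/
noncomputable def gsomMatching {β σ : Type*} [LinearOrder β] [LinearOrder σ]
    (E : Finset (β × σ)) (DB : β → Measure ℝ) (b : β → ℝ) (s : σ → ℝ) : Finset (β × σ) :=
  chosenMatching E (fun e => ironedVirtualValue (DB e.1) (b e.1) - ((s e.2 : ℝ) : EReal))

/-- The pairs that trade in the Generalized Buyer-Offering Mechanism. -/
noncomputable def gbomMatching {β σ : Type*} [LinearOrder β] [LinearOrder σ]
    (E : Finset (β × σ)) (DS : σ → Measure ℝ) (b : β → ℝ) (s : σ → ℝ) : Finset (β × σ) :=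
  chosenMatching E (fun e => ((b e.1 : ℝ) : EReal) - ironedVirtualCost (DS e.2) (s e.2))

/-- The gains from trade of the RVWM mechanism on `(b, s)`, in expectation over its fair coin. -/
noncomputable def rvwmGFT {β σ : Type*} [LinearOrder β] [LinearOrder σ]
    (E : Finset (β × σ)) (DB : β → Measure ℝ) (DS : σ → Measure ℝ) (b : β → ℝ) (s : σ → ℝ) : ℝ :=
  (1 / 2) * gainsFromTrade b s (gsomMatching E DB b s) +
  (1 / 2) * gainsFromTrade b s (gbomMatching E DS b s)

/-! ### The bilateral seller-offering, buyer-offering and randomized-offerer mechanisms -/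

/-- Expected utility of a seller with cost `s` who offers the price `p` to a buyer with value
drawn from `D`, who accepts iff her value is at least `p`. -/
noncomputable def sellerUtility (D : Measure ℝ) (s p : ℝ) : ℝ := (p - s) * D.real (Set.Ici p)

/-- Expected utility of a buyer with value `b` who offers the price `p` to a seller with cost
drawn from `D`, who accepts iff her cost is at most `p`. -/
noncomputable def buyerUtility (D : Measure ℝ) (b p : ℝ) : ℝ := (b - p) * D.real (Set.Iic p)

/-- `p` is the lowest among the prices that maximize the seller's expected utility subject to the
offer constraint `p ≤ sbar`. -/
def IsSellerOffer (D : Measure ℝ) (s : ℝ) (sbar : EReal) (p : ℝ) : Prop :=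
  IsLeast {p : ℝ | (p : EReal) ≤ sbar ∧
    ∀ p' : ℝ, (p' : EReal) ≤ sbar → sellerUtility D s p' ≤ sellerUtility D s p} p

/-- `p` is the highest among the prices that maximize the buyer's expected utility subject to the
offer constraint `p ≥ bbar`. -/
def IsBuyerOffer (D : Measure ℝ) (b : ℝ) (bbar : ℝ) (p : ℝ) : Prop :=
  IsGreatest {p : ℝ | bbar ≤ p ∧
    ∀ p' : ℝ, bbar ≤ p' → buyerUtility D b p' ≤ buyerUtility D b p} p

/-- Trade occurs in the SO mechanism with offer constraint `sbar` and target distribution `D`. -/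
def SOTrades (sbar : EReal) (D : Measure ℝ) (b s : ℝ) : Prop :=
  ∃ p, IsSellerOffer D s sbar p ∧ p ≤ b

/-- Trade occurs in the BO mechanism with offer constraint `bbar` and target distribution `D`. -/
def BOTrades (bbar : ℝ) (D : Measure ℝ) (b s : ℝ) : Prop :=
  ∃ p, IsBuyerOffer D b bbar p ∧ s ≤ p

open Classical in
/-- The gains from trade, in expectation over the fair coin, of the RO mechanism with SO parameters
`sbar`, `Db` and BO parameters `bbar`, `Ds` between a buyer with value `b` and a seller with cost
`s`. -/
noncomputable def roGFT (sbar : EReal) (Db : Measure ℝ) (bbar : ℝ) (Ds : Measure ℝ)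
    (b s : ℝ) : ℝ :=
  (1 / 2) * (if SOTrades sbar Db b s then b - s else 0) +
  (1 / 2) * (if BOTrades bbar Ds b s then b - s else 0)

/-! ### The Offering Mechanism for matching markets -/

/-- The market without buyer `i`. -/
def removeBuyer {β σ : Type*} [DecidableEq β] (E : Finset (β × σ)) (i : β) : Finset (β × σ) :=
  E.filter (fun e => e.1 ≠ i)

/-- The market without seller `j`. -/
def removeSeller {β σ : Type*} [DecidableEq σ] (E : Finset (β × σ)) (j : σ) : Finset (β × σ) :=
  E.filter (fun e => e.2 ≠ j)

/-- The minimal bid `x` of buyer `i` such that any higher bid causes her to be in the first-best of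
the market without seller `j`; it is `∞` if there is no such bid. -/
noncomputable def sBar {β σ : Type*} [LinearOrder β] [LinearOrder σ]
    (E : Finset (β × σ)) (b : β → ℝ) (s : σ → ℝ) (i : β) (j : σ) : EReal :=
  sInf ((fun x : ℝ => (x : EReal)) '' {x : ℝ | 0 ≤ x ∧ ∀ y, x < y →
    ∃ e ∈ firstBest (removeSeller E j) (Function.update b i y) s, e.1 = i})

/-- The maximal (supremal, as the threshold bid itself may lose a tie) bid `x` of seller `j` that
causes her to be in the first-best of the market without buyer `i`; it is `0` if there is no such
bid (`sSup ∅ = 0`). -/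
noncomputable def bBar {β σ : Type*} [LinearOrder β] [LinearOrder σ]
    (E : Finset (β × σ)) (b : β → ℝ) (s : σ → ℝ) (i : β) (j : σ) : ℝ :=
  sSup {x : ℝ | 0 ≤ x ∧
    ∃ e ∈ firstBest (removeBuyer E i) b (Function.update s j x), e.2 = j}

/-- The gains from trade of the Offering Mechanism on `(b, s)`, in expectation over its coin: on
each edge of the first-best matching, run the RO mechanism with SO parameters `sBar` and the
buyer's distribution conditioned on values at least `bBar`, and BO parameters `bBar` and the
seller's distribution conditioned on costs at most `sBar`.  (By linearity it does not matter
whether the coins of different edges are independent.) -/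
noncomputable def offeringGFT {β σ : Type*} [LinearOrder β] [LinearOrder σ]
    (E : Finset (β × σ)) (DB : β → Measure ℝ) (DS : σ → Measure ℝ) (b : β → ℝ) (s : σ → ℝ) : ℝ :=
  ∑ e ∈ firstBest E b s,
    roGFT (sBar E b s e.1 e.2)
      (cond (DB e.1) (Set.Ici (bBar E b s e.1 e.2)))
      (bBar E b s e.1 e.2)
      (cond (DS e.2) {x : ℝ | (x : EReal) ≤ sBar E b s e.1 e.2})
      (b e.1) (s e.2)

/-!
Let `M` be the first-best matching, and let `D` be the set of its edges with positive gains on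
which neither of the two offers leads to trade.  The Offering Mechanism gains at least half of
the gains from trade of `M \ D`, so it is enough that `M \ D` gains at least as much as each of the
two virtual-welfare maximizing matchings `V`.

**A single edge.**  Take an edge `(i, j)` of `M` with `s j < b i`.  If `sBar ≤ b i`, then the
seller has to ask for a price that the buyer accepts, and if `s j ≤ bBar`, then the buyer has to
offer a price that the seller accepts (`trades_of_constraint`).  Otherwise, conditioning on values
from `bBar < s j` on only rescales the seller's utility from the prices that cover her cost, and
if the ironed virtual value of `i` is at least `s j`, then her lowest optimal price is at most
`b i`: were a price above `b i` strictly
better than all prices in `[s j, b i]`, a supporting line of the convex hull of the negated revenue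
curve could be tilted, and its slope just above `b i` would be less than `s j`
(`sellerUtility_le_of_le_ironedVirtualValue`).  The same holds for buyer offers and ironed
virtual costs.  So edges of `D` satisfy `bBar < s j` and `b i < sBar`, and their virtual weights
are negative in both virtual markets.

**The matching.**  For `e = (i, j)` in `D`, the constraints say that `M \ {e}` is still optimal
in the market without `i`, and in the market without `j` (`gainsFromTrade_le_of_bBar_lt`,
`gainsFromTrade_le_of_lt_sBar`).  Consider the components of `V ∪ (M \ D)`.  On a component that
meets no edge of `D`, or only one end point of one such edge, optimality of `M` or of `M \ {e}`
shows that `V` gains no more than `M \ D`.  The remaining case would be an alternating path from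
the buyer `i` of some `e ∈ D` to the seller `j'` of some `e' ∈ D`.  Optimality of `V` then makes
the virtual weight of `(i, j')` nonnegative, which is absurd if `e = e'`; if `e ≠ e'`, exchanging
along the path in `M \ {e'}` and in `M \ {e}` gives `s j ≤ s j'` and `b i ≤ b i'`, and one of these
contradicts the negative virtual weights of `e` and `e'` (`gainsFromTrade_le_sdiff`).

The proof that the two conditioning events are not both null uses `bBar ≤ sBar`, which holds because
buyers and sellers are complements (`gainsFromTrade_add_le_of_complements`).
-/

/-! ### Exchange arguments for matchings -/

section Matchings

variable {β σ : Type*}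

/-- The vertex set consisting of the buyers in `X` and the sellers in `Y` is a union of connected
components of the graph `N`. -/
def ClosedUnder (N : Finset (β × σ)) (X : Set β) (Y : Set σ) : Prop :=
  ∀ e ∈ N, e.1 ∈ X ↔ e.2 ∈ Y

open Classical in
/-- The edges of `N` whose buyer lies in `X`. -/
noncomputable def edgesIn (N : Finset (β × σ)) (X : Set β) : Finset (β × σ) :=
  N.filter fun e => e.1 ∈ X

theorem mem_edgesIn {N : Finset (β × σ)} {X : Set β} {e : β × σ} :
    e ∈ edgesIn N X ↔ e ∈ N ∧ e.1 ∈ X := by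
  classical
  simp [edgesIn]

theorem ClosedUnder.mono {N N' : Finset (β × σ)} {X : Set β} {Y : Set σ}
    (h : ClosedUnder N X Y) (hN : N' ⊆ N) : ClosedUnder N' X Y := fun e he => h e (hN he)

theorem ClosedUnder.inter {N : Finset (β × σ)} {X X' : Set β} {Y Y' : Set σ}
    (h : ClosedUnder N X Y) (h' : ClosedUnder N X' Y') :
    ClosedUnder N (X ∩ X') (Y ∩ Y') := fun e he => and_congr (h e he) (h' e he)

theorem ClosedUnder.diff {N : Finset (β × σ)} {X X' : Set β} {Y Y' : Set σ}
    (h : ClosedUnder N X Y) (h' : ClosedUnder N X' Y') :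
    ClosedUnder N (X \ X') (Y \ Y') := fun e he => and_congr (h e he) (not_congr (h' e he))

theorem IsMatchingIn.eq_of_fst {E M : Finset (β × σ)} (h : IsMatchingIn E M) {e f : β × σ}
    (he : e ∈ M) (hf : f ∈ M) (hef : e.1 = f.1) : e = f := h.2 e he f hf (Or.inl hef)

theorem IsMatchingIn.eq_of_snd {E M : Finset (β × σ)} (h : IsMatchingIn E M) {e f : β × σ}
    (he : e ∈ M) (hf : f ∈ M) (hef : e.2 = f.2) : e = f := h.2 e he f hf (Or.inr hef)

theorem IsMatchingIn.subset {E M M' : Finset (β × σ)} (h : IsMatchingIn E M) (hM : M' ⊆ M) :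
    IsMatchingIn E M' :=
  ⟨hM.trans h.1, fun e he f hf => h.2 e (hM he) f (hM hf)⟩

theorem IsMatchingIn.mono {E E' M : Finset (β × σ)} (h : IsMatchingIn E M) (hE : E ⊆ E') :
    IsMatchingIn E' M := ⟨h.1.trans hE, h.2⟩

theorem IsMatchingIn.cons {E M : Finset (β × σ)} [DecidableEq (β × σ)] (h : IsMatchingIn E M)
    {e : β × σ} (he : e ∈ E) (h1 : ∀ f ∈ M, f.1 ≠ e.1) (h2 : ∀ f ∈ M, f.2 ≠ e.2) :
    IsMatchingIn E (insert e M) := by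
  refine ⟨Finset.insert_subset he h.1, fun f hf g hg hfg => ?_⟩
  rcases Finset.mem_insert.1 hf with hf' | hf' <;> rcases Finset.mem_insert.1 hg with hg' | hg'
  · rw [hf', hg']
  · rw [hf'] at hfg
    rcases hfg with hfg | hfg
    · exact absurd hfg.symm (h1 g hg')
    · exact absurd hfg.symm (h2 g hg')
  · rw [hg'] at hfg
    rcases hfg with hfg | hfg
    · exact absurd hfg (h1 f hf')
    · exact absurd hfg (h2 f hf')
  · exact h.2 f hf' g hg' hfg

theorem IsMatchingIn.removeBuyer [DecidableEq β] {E M : Finset (β × σ)} (h : IsMatchingIn E M)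
    {i : β} (hi : ∀ e ∈ M, e.1 ≠ i) : IsMatchingIn (removeBuyer E i) M :=
  ⟨fun e he => Finset.mem_filter.2 ⟨h.1 he, hi e he⟩, h.2⟩

theorem IsMatchingIn.removeSeller [DecidableEq σ] {E M : Finset (β × σ)} (h : IsMatchingIn E M)
    {j : σ} (hj : ∀ e ∈ M, e.2 ≠ j) : IsMatchingIn (removeSeller E j) M :=
  ⟨fun e he => Finset.mem_filter.2 ⟨h.1 he, hj e he⟩, h.2⟩

open Classical in
/-- The matching that agrees with `V` on the vertex set given by the buyers in `X`, and with `N`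
elsewhere. -/
noncomputable def exchange (N V : Finset (β × σ)) (X : Set β) : Finset (β × σ) :=
  (N \ edgesIn N X) ∪ edgesIn V X

theorem mem_exchange {N V : Finset (β × σ)} {X : Set β} {e : β × σ} :
    e ∈ exchange N V X ↔ (e ∈ N ∧ e.1 ∉ X) ∨ (e ∈ V ∧ e.1 ∈ X) := by
  classical
  simp only [exchange, Finset.mem_union, Finset.mem_sdiff, mem_edgesIn]
  tauto

theorem isMatchingIn_exchange {E N V : Finset (β × σ)} {X : Set β} {Y : Set σ}
    (hN : IsMatchingIn E N) (hV : IsMatchingIn E V)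
    (hNX : ClosedUnder N X Y) (hVX : ClosedUnder V X Y) : IsMatchingIn E (exchange N V X) := by
  refine ⟨fun e he => ?_, fun e he f hf hef => ?_⟩
  · rcases mem_exchange.1 he with h | h
    exacts [hN.1 h.1, hV.1 h.1]
  · rcases mem_exchange.1 he with ⟨he, heX⟩ | ⟨he, heX⟩ <;>
      rcases mem_exchange.1 hf with ⟨hf, hfX⟩ | ⟨hf, hfX⟩
    · exact hN.2 e he f hf hef
    · rcases hef with h | h
      · exact absurd (h ▸ hfX) heX
      · exact absurd ((hNX e he).2 (h ▸ (hVX f hf).1 hfX)) heX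
    · rcases hef with h | h
      · exact absurd (h ▸ heX) hfX
      · exact absurd ((hNX f hf).2 (h ▸ (hVX e he).1 heX)) hfX
    · exact hV.2 e he f hf hef

theorem gainsFromTrade_exchange (b : β → ℝ) (s : σ → ℝ) (N V : Finset (β × σ)) (X : Set β) :
    gainsFromTrade b s (exchange N V X) =
      gainsFromTrade b s N - gainsFromTrade b s (edgesIn N X)
        + gainsFromTrade b s (edgesIn V X) := by
  classical
  have hd : Disjoint (N \ edgesIn N X) (edgesIn V X) := by
    rw [Finset.disjoint_left]
    intro e he he'
    simp only [Finset.mem_sdiff, mem_edgesIn] at he he'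
    exact he.2 ⟨he.1, he'.2⟩
  have hs : edgesIn N X ⊆ N := Finset.filter_subset _ _
  unfold gainsFromTrade exchange
  rw [Finset.sum_union hd, ← Finset.sum_sdiff hs]
  ring

theorem gainsFromTrade_edgesIn_inter_add_diff (b : β → ℝ) (s : σ → ℝ) (N : Finset (β × σ))
    (X X' : Set β) :
    gainsFromTrade b s (edgesIn N (X ∩ X')) + gainsFromTrade b s (edgesIn N (X \ X')) =
      gainsFromTrade b s (edgesIn N X) := by
  classical
  unfold gainsFromTrade
  rw [← Finset.sum_union]
  · congr 1
    ext e
    simp only [Finset.mem_union, mem_edgesIn, Set.mem_inter_iff, Set.mem_sdiff]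
    tauto
  · rw [Finset.disjoint_left]
    intro e he he'
    simp only [mem_edgesIn, Set.mem_inter_iff, Set.mem_sdiff] at he he'
    exact he'.2.2 he.2.2

theorem gainsFromTrade_erase_add [DecidableEq (β × σ)] (b : β → ℝ) (s : σ → ℝ)
    {N : Finset (β × σ)} {e : β × σ} (he : e ∈ N) :
    gainsFromTrade b s (N.erase e) + (b e.1 - s e.2) = gainsFromTrade b s N :=
  Finset.sum_erase_add N (fun e => b e.1 - s e.2) he

theorem gainsFromTrade_insert [DecidableEq (β × σ)] (b : β → ℝ) (s : σ → ℝ)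
    {N : Finset (β × σ)} {e : β × σ} (he : e ∉ N) :
    gainsFromTrade b s (insert e N) = (b e.1 - s e.2) + gainsFromTrade b s N :=
  Finset.sum_insert he

/-- The alternating path that starts at a vertex `i` missed by `Q` and uses the edges of `P` and
`Q` in turn: its vertex set is closed under `P` and `Q`.  The relations `P` and `Q` are matchings;
only the halves of this assumption that the argument uses are made. -/
theorem exists_alternating_path {α γ : Type*} (P Q : α → γ → Prop)
    (hP : ∀ x x' y, P x y → P x' y → x = x')
    (hQ : ∀ x y y', Q x y → Q x y' → y = y') (i : α) (hi : ∀ y, ¬ Q i y) :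
    ∃ (X : Set α) (Y : Set γ), i ∈ X ∧ (∀ x y, P x y → (x ∈ X ↔ y ∈ Y)) ∧
      (∀ x y, Q x y → (x ∈ X ↔ y ∈ Y)) ∧ (∀ y ∈ Y, ∃ x, P x y) ∧
      (∀ x ∈ X, x ≠ i → ∃ y, Q x y) := by
  let r : α → α → Prop := fun x x' => ∃ y, P x y ∧ Q x' y
  refine ⟨{x | Relation.ReflTransGen r i x}, {y | ∃ x, Relation.ReflTransGen r i x ∧ P x y},
    .refl, fun x y hxy => ⟨fun hx => ⟨x, hx, hxy⟩, ?_⟩, fun x y hxy => ⟨fun hx => ?_, ?_⟩,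
    fun y ⟨x, _, hxy⟩ => ⟨x, hxy⟩, fun x hx hne => ?_⟩
  · rintro ⟨x', hx', hxy'⟩
    exact hP _ _ _ hxy' hxy ▸ hx'
  · rcases Relation.ReflTransGen.cases_tail hx with h | ⟨x', hx', y', h1, h2⟩
    · exact absurd (h ▸ hxy) (hi y)
    · exact ⟨x', hx', hQ _ _ _ h2 hxy ▸ h1⟩
  · rintro ⟨x', hx', hxy'⟩
    exact hx'.tail ⟨y, hxy', hxy⟩
  · rcases Relation.ReflTransGen.cases_tail hx with h | ⟨x', _, y', _, h2⟩
    · exact absurd h hne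
    · exact ⟨y', h2⟩

theorem exists_closedUnder_of_buyer {E V N : Finset (β × σ)} (hV : IsMatchingIn E V)
    (hN : IsMatchingIn E N) (i : β) (hi : ∀ e ∈ N, e.1 ≠ i) :
    ∃ (X : Set β) (Y : Set σ), i ∈ X ∧ ClosedUnder V X Y ∧ ClosedUnder N X Y ∧
      (∀ y ∈ Y, ∃ e ∈ V, e.2 = y) ∧ (∀ x ∈ X, x ≠ i → ∃ e ∈ N, e.1 = x) := by
  obtain ⟨X, Y, h1, h2, h3, h4, h5⟩ := exists_alternating_path
    (fun x y => (x, y) ∈ V) (fun x y => (x, y) ∈ N)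
    (fun x x' y h h' => congrArg Prod.fst (hV.eq_of_snd h h' rfl))
    (fun x y y' h h' => congrArg Prod.snd (hN.eq_of_fst h h' rfl)) i
    (fun y h => hi _ h rfl)
  refine ⟨X, Y, h1, fun e he => h2 e.1 e.2 he, fun e he => h3 e.1 e.2 he, fun y hy => ?_,
    fun x hx hne => ?_⟩
  · obtain ⟨x, hx⟩ := h4 y hy
    exact ⟨_, hx, rfl⟩
  · obtain ⟨y, hy⟩ := h5 x hx hne
    exact ⟨_, hy, rfl⟩

theorem exists_closedUnder_of_seller {E V N : Finset (β × σ)} (hV : IsMatchingIn E V)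
    (hN : IsMatchingIn E N) (j : σ) (hj : ∀ e ∈ N, e.2 ≠ j) :
    ∃ (X : Set β) (Y : Set σ), j ∈ Y ∧ ClosedUnder V X Y ∧ ClosedUnder N X Y ∧
      (∀ y ∈ Y, y ≠ j → ∃ e ∈ N, e.2 = y) := by
  obtain ⟨Y, X, h1, h2, h3, -, h5⟩ := exists_alternating_path
    (fun y x => (x, y) ∈ V) (fun y x => (x, y) ∈ N)
    (fun x x' y h h' => congrArg Prod.snd (hV.eq_of_fst h h' rfl))
    (fun x y y' h h' => congrArg Prod.fst (hN.eq_of_snd h h' rfl)) j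
    (fun y h => hj _ h rfl)
  refine ⟨X, Y, h1, fun e he => (h2 e.2 e.1 he).symm, fun e he => (h3 e.2 e.1 he).symm,
    fun y hy hne => ?_⟩
  obtain ⟨x, hx⟩ := h5 y hy hne
  exact ⟨_, hx, rfl⟩

/-- An alternating path from a buyer `i` to a seller `j` that begins and ends with edges of `V`:
the `V`-edges cover all of its vertices and the `N`-edges all but `i` and `j`, so the weights of
the two sets of edges differ by the contribution of `i` and `j`. -/
theorem gainsFromTrade_alternating_path [Finite β] [Finite σ] {E V N : Finset (β × σ)}
    (hV : IsMatchingIn E V)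
    (hN : IsMatchingIn E N) {X : Set β} {Y : Set σ} {i : β} {j : σ} (hi : i ∈ X) (hj : j ∈ Y)
    (hVX : ClosedUnder V X Y) (hNX : ClosedUnder N X Y)
    (hY : ∀ y ∈ Y, ∃ e ∈ V, e.2 = y) (hX : ∀ x ∈ X, x ≠ i → ∃ e ∈ N, e.1 = x)
    (hiN : ∀ e ∈ N, e.1 ≠ i) (hjN : ∀ e ∈ N, e.2 ≠ j) :
    (∀ x ∈ X, ∃ e ∈ V, e.1 = x) ∧ (∀ y ∈ Y, y ≠ j → ∃ e ∈ N, e.2 = y) ∧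
    ∀ (a : β → ℝ) (c : σ → ℝ), gainsFromTrade a c (edgesIn V X) =
      gainsFromTrade a c (edgesIn N X) + (a i - c j) := by
  classical
  have := Fintype.ofFinite β
  have := Fintype.ofFinite σ
  set A : Finset β := Finset.univ.filter (· ∈ X) with hA
  set B : Finset σ := Finset.univ.filter (· ∈ Y) with hB
  have hAX : ∀ x, x ∈ A ↔ x ∈ X := by simp [hA]
  have hBY : ∀ y, y ∈ B ↔ y ∈ Y := by simp [hB]
  have inj1 : ∀ {W : Finset (β × σ)}, IsMatchingIn E W →
      Set.InjOn Prod.fst (edgesIn W X : Set (β × σ)) := fun hW e he f hf h =>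
    hW.eq_of_fst (mem_edgesIn.1 he).1 (mem_edgesIn.1 hf).1 h
  have inj2 : ∀ {W : Finset (β × σ)}, IsMatchingIn E W →
      Set.InjOn Prod.snd (edgesIn W X : Set (β × σ)) := fun hW e he f hf h =>
    hW.eq_of_snd (mem_edgesIn.1 he).1 (mem_edgesIn.1 hf).1 h
  have hV2 : (edgesIn V X).image Prod.snd = B := by
    ext y
    simp only [Finset.mem_image, mem_edgesIn, hBY]
    constructor
    · rintro ⟨e, ⟨he, heX⟩, rfl⟩
      exact (hVX e he).1 heX
    · intro hy
      obtain ⟨e, he, rfl⟩ := hY y hy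
      exact ⟨e, ⟨he, (hVX e he).2 hy⟩, rfl⟩
  have hN1 : (edgesIn N X).image Prod.fst = A.erase i := by
    ext x
    simp only [Finset.mem_image, mem_edgesIn, hAX, Finset.mem_erase]
    constructor
    · rintro ⟨e, ⟨he, heX⟩, rfl⟩
      exact ⟨hiN e he, heX⟩
    · rintro ⟨hne, hx⟩
      obtain ⟨e, he, rfl⟩ := hX x hx hne
      exact ⟨e, ⟨he, hx⟩, rfl⟩
  have hV1s : (edgesIn V X).image Prod.fst ⊆ A := by
    intro x hx
    obtain ⟨e, he, rfl⟩ := Finset.mem_image.1 hx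
    exact (hAX _).2 (mem_edgesIn.1 he).2
  have hN2s : (edgesIn N X).image Prod.snd ⊆ B.erase j := by
    intro x hx
    obtain ⟨e, he, rfl⟩ := Finset.mem_image.1 hx
    have h := mem_edgesIn.1 he
    exact Finset.mem_erase.2 ⟨hjN e h.1, (hBY _).2 ((hNX e h.1).1 h.2)⟩
  -- Both inclusions are equalities, because the four cardinalities interlace.
  have c1 := Finset.card_image_of_injOn (inj1 hV)
  have c2 := Finset.card_image_of_injOn (inj2 hV)
  have c3 := Finset.card_image_of_injOn (inj1 hN)
  have c4 := Finset.card_image_of_injOn (inj2 hN)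
  have d1 := Finset.card_le_card hV1s
  have d2 := Finset.card_le_card hN2s
  rw [hV2] at c2
  rw [hN1] at c3
  have e1 := Finset.card_erase_add_one ((hAX i).2 hi)
  have e2 := Finset.card_erase_add_one ((hBY j).2 hj)
  have hV1 := Finset.eq_of_subset_of_card_le hV1s (by omega)
  have hN2 := Finset.eq_of_subset_of_card_le hN2s (by omega)
  refine ⟨fun x hx => ?_, fun y hy hne => ?_, fun a c => ?_⟩
  · rw [← hAX, ← hV1] at hx
    obtain ⟨e, he, rfl⟩ := Finset.mem_image.1 hx
    exact ⟨e, (mem_edgesIn.1 he).1, rfl⟩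
  · have hy' := Finset.mem_erase.2 ⟨hne, (hBY y).2 hy⟩
    rw [← hN2] at hy'
    obtain ⟨e, he, rfl⟩ := Finset.mem_image.1 hy'
    exact ⟨e, (mem_edgesIn.1 he).1, rfl⟩
  · unfold gainsFromTrade
    rw [Finset.sum_sub_distrib, Finset.sum_sub_distrib,
      ← Finset.sum_image (f := a) (inj1 hV), ← Finset.sum_image (f := c) (inj2 hV),
      ← Finset.sum_image (f := a) (inj1 hN), ← Finset.sum_image (f := c) (inj2 hN),
      hV1, hV2, hN1, hN2, ← Finset.add_sum_erase A a ((hAX i).2 hi),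
      ← Finset.add_sum_erase B c ((hBY j).2 hj)]
    ring

end Matchings

/-! ### Matchings that survive the removal of blocked edges -/

section Blocked

variable {β σ : Type*}

theorem edgesIn_mono {N N' : Finset (β × σ)} {X : Set β}
    (h : ∀ e ∈ N, e.1 ∈ X → e ∈ N') : edgesIn N X ⊆ edgesIn N' X := fun e he =>
  mem_edgesIn.2 ⟨h e (mem_edgesIn.1 he).1 (mem_edgesIn.1 he).2, (mem_edgesIn.1 he).2⟩

/-- A matching `N` of maximum weight in `E'` outweighs `V` on every union of components of `N ∪ V`
on which it can be exchanged for `V` without leaving `E'`. -/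
theorem gainsFromTrade_edgesIn_le {E E' N V : Finset (β × σ)} {b : β → ℝ} {s : σ → ℝ}
    {X : Set β} {Y : Set σ}
    (hN : IsMatchingIn E N) (hV : IsMatchingIn E V)
    (hNX : ClosedUnder N X Y) (hVX : ClosedUnder V X Y)
    (hE' : exchange N V X ⊆ E')
    (hopt : ∀ N', IsMatchingIn E' N' → gainsFromTrade b s N' ≤ gainsFromTrade b s N) :
    gainsFromTrade b s (edgesIn V X) ≤ gainsFromTrade b s (edgesIn N X) := by
  have h := hopt _ ⟨hE', (isMatchingIn_exchange hN hV hNX hVX).2⟩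
  rw [gainsFromTrade_exchange] at h
  linarith

/-- Let `M` have maximum weight for `b - s`, and let `D` be a set of edges of `M` such that, for
each `e ∈ D`, the matching `M \ {e}` is still optimal after the removal of the buyer of `e`, and
after the removal of the seller of `e`.  Let `V` have maximum weight for some other weights `a - c`
among the matchings of its own vertices.  If no edge of `D` is acceptable for the weights `a - c`
and no pair of edges of `D` could be improved upon by a path of `V`, then `M \ D` still has at
least the `b - s` weight of `V`. -/
theorem gainsFromTrade_le_sdiff [Finite β] [Finite σ] [DecidableEq β] [DecidableEq σ]
    {E M V D : Finset (β × σ)} {b a : β → ℝ} {s c : σ → ℝ}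
    (hM : IsMatchingIn E M)
    (hMopt : ∀ N, IsMatchingIn E N → gainsFromTrade b s N ≤ gainsFromTrade b s M)
    (hDM : D ⊆ M)
    (hDb : ∀ e ∈ D, ∀ N, IsMatchingIn (removeBuyer E e.1) N →
      gainsFromTrade b s N ≤ gainsFromTrade b s (M.erase e))
    (hDs : ∀ e ∈ D, ∀ N, IsMatchingIn (removeSeller E e.2) N →
      gainsFromTrade b s N ≤ gainsFromTrade b s (M.erase e))
    (hV : IsMatchingIn E V)
    (hVopt : ∀ N, IsMatchingIn E N → (∀ f ∈ N, (∃ g ∈ V, g.1 = f.1) ∧ ∃ g ∈ V, g.2 = f.2) →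
      gainsFromTrade a c N ≤ gainsFromTrade a c V)
    (hself : ∀ e ∈ D, (∃ g ∈ V, g.1 = e.1) → (∃ g ∈ V, g.2 = e.2) → a e.1 < c e.2)
    (hpair : ∀ e ∈ D, ∀ e' ∈ D, e ≠ e' → (∃ g ∈ V, g.1 = e.1) → (∃ g ∈ V, g.2 = e'.2) →
      c e'.2 ≤ a e.1 → s e.2 ≤ s e'.2 → b e.1 ≤ b e'.1 → False) :
    gainsFromTrade b s V ≤ gainsFromTrade b s (M \ D) := by
  classical
  set N := M \ D with hNdef
  have hNM : N ⊆ M := Finset.sdiff_subset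
  have hN : IsMatchingIn E N := hM.subset hNM
  have memN : ∀ {e}, e ∈ M → e ∉ D → e ∈ N := fun h h' => Finset.mem_sdiff.2 ⟨h, h'⟩
  have N1 : ∀ {e}, e ∈ D → ∀ f ∈ N, f.1 ≠ e.1 := fun {e} he f hf h =>
    (Finset.mem_sdiff.1 hf).2 (hM.eq_of_fst (hNM hf) (hDM he) h ▸ he)
  have N2 : ∀ {e}, e ∈ D → ∀ f ∈ N, f.2 ≠ e.2 := fun {e} he f hf h =>
    (Finset.mem_sdiff.1 hf).2 (hM.eq_of_snd (hNM hf) (hDM he) h ▸ he)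
  -- An alternating path that leaves a buyer of `D` never arrives at a seller of `D`.
  have nopath : ∀ e ∈ D, ∀ (X : Set β) (Y : Set σ), e.1 ∈ X → ClosedUnder V X Y →
      ClosedUnder N X Y → (∀ y ∈ Y, ∃ f ∈ V, f.2 = y) →
      (∀ x ∈ X, x ≠ e.1 → ∃ f ∈ N, f.1 = x) → ∀ e' ∈ D, e'.2 ∉ Y := by
    intro e he X Y heX hVX hNX hY hX e' he' he'Y
    obtain ⟨hX', hY', hsum⟩ := gainsFromTrade_alternating_path hV hN heX he'Y hVX hNX hY hX
      (N1 he) (N2 he')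
    have hle : c e'.2 ≤ a e.1 := by
      have h := hVopt _ (isMatchingIn_exchange hV hN hVX hNX) (fun f hf => by
        rcases mem_exchange.1 hf with ⟨hf, _⟩ | ⟨hf, hfX⟩
        · exact ⟨⟨f, hf, rfl⟩, f, hf, rfl⟩
        · exact ⟨hX' _ hfX, hY _ ((hNX f hf).1 hfX)⟩)
      rw [gainsFromTrade_exchange, hsum a c] at h
      linarith
    have hc1 := hX' _ heX
    have hc2 := hY _ he'Y
    by_cases hee : e = e'
    · subst hee
      exact absurd hle (not_le.2 (hself e he hc1 hc2))
    -- The path is swapped in, in exchange for both `e` and `e'`.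
    set R := (M.erase e).erase e' with hR
    have hRM : R ⊆ M := (Finset.erase_subset _ _).trans (Finset.erase_subset _ _)
    have hDX : ∀ f ∈ D, f ≠ e → f.1 ∉ X := fun f hf hne hfX => by
      obtain ⟨g, hg, hgf⟩ := hX _ hfX (fun h => hne (hM.eq_of_fst (hDM hf) (hDM he) h))
      exact N1 hf g hg hgf
    have hDY : ∀ f ∈ D, f ≠ e' → f.2 ∉ Y := fun f hf hne hfY => by
      obtain ⟨g, hg, hgf⟩ := hY' _ hfY (fun h => hne (hM.eq_of_snd (hDM hf) (hDM he') h))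
      exact N2 hf g hg hgf
    have hRX : ClosedUnder R X Y := by
      intro f hf
      have hfe' : f ≠ e' := (Finset.mem_erase.1 hf).1
      have hfe : f ≠ e := (Finset.mem_erase.1 (Finset.mem_erase.1 hf).2).1
      by_cases hfD : f ∈ D
      · exact iff_of_false (hDX f hfD hfe) (hDY f hfD hfe')
      · exact hNX f (memN (hRM hf) hfD)
    have hRN : edgesIn R X = edgesIn N X := by
      ext f
      rw [mem_edgesIn, mem_edgesIn]
      refine and_congr_left fun hfX => ⟨fun hf => memN (hRM hf) fun hfD => ?_, fun hf => ?_⟩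
      · exact hDX f hfD (Finset.mem_erase.1 (Finset.mem_erase.1 hf).2).1 hfX
      · refine Finset.mem_erase.2 ⟨?_, Finset.mem_erase.2 ⟨?_, hNM hf⟩⟩
        · rintro rfl
          exact N1 he' _ hf rfl
        · rintro rfl
          exact N1 he _ hf rfl
    have hW := isMatchingIn_exchange (hM.subset hRM) hV hRX hVX
    have hWw := gainsFromTrade_exchange b s R V X
    rw [hRN, hsum b s] at hWw
    have w1 := gainsFromTrade_erase_add b s (hDM he)
    have w2 := gainsFromTrade_erase_add b s (hDM he')
    have w3 := gainsFromTrade_erase_add b s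
      (Finset.mem_erase.2 ⟨Ne.symm hee, hDM he'⟩ : e' ∈ M.erase e)
    rw [← hR] at w3
    have hb' := hDb e' he' _ (hW.removeBuyer fun f hf h => by
      rcases mem_exchange.1 hf with ⟨hf, _⟩ | ⟨hf, hfX⟩
      · exact (Finset.mem_erase.1 hf).1 (hM.eq_of_fst (hRM hf) (hDM he') h)
      · exact hDX e' he' (Ne.symm hee) (h ▸ hfX))
    have hs' := hDs e he _ (hW.removeSeller fun f hf h => by
      rcases mem_exchange.1 hf with ⟨hf, _⟩ | ⟨hf, hfX⟩
      · exact (Finset.mem_erase.1 (Finset.mem_erase.1 hf).2).1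
          (hM.eq_of_snd (hRM hf) (hDM he) h)
      · exact hDY e he hee (h ▸ (hVX f hf).1 hfX))
    exact hpair e he e' he' hee hc1 hc2 hle (by linarith) (by linarith)
  -- On a vertex set that meets `D` in one vertex only, `M` without one edge is optimal.
  have one_buyer : ∀ e ∈ D, ∀ (X : Set β) (Y : Set σ), ClosedUnder V X Y → ClosedUnder N X Y →
      (∀ f ∈ D, f.1 ∈ X → f = e) → (∀ f ∈ D, f.2 ∉ Y) →
      gainsFromTrade b s (edgesIn V X) ≤ gainsFromTrade b s (edgesIn N X) := by
    intro e he X Y hVX hNX h1 h2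
    have hMN : edgesIn (M.erase e) X = edgesIn N X := by
      refine (edgesIn_mono fun f hf hfX => ?_).antisymm (edgesIn_mono fun f hf _ => ?_)
      · exact memN (Finset.mem_of_mem_erase hf)
          fun hfD => Finset.ne_of_mem_erase hf (h1 f hfD hfX)
      · exact Finset.mem_erase.2 ⟨fun h => N1 he f hf (h ▸ rfl), hNM hf⟩
    have hMX : ClosedUnder (M.erase e) X Y := fun f hf => by
      have hf' := Finset.mem_erase.1 hf
      by_cases hfD : f ∈ D
      · exact iff_of_false (fun h => hf'.1 (h1 f hfD h)) (h2 f hfD)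
      · exact hNX f (memN hf'.2 hfD)
    rw [← hMN]
    refine gainsFromTrade_edgesIn_le (hM.subset (Finset.erase_subset _ _)) hV hMX hVX ?_
      (hDs e he)
    refine ((isMatchingIn_exchange (hM.subset (Finset.erase_subset _ _)) hV hMX
      hVX).removeSeller fun f hf h => ?_).1
    rcases mem_exchange.1 hf with ⟨hf, _⟩ | ⟨hf, hfX⟩
    · exact (Finset.mem_erase.1 hf).1 (hM.eq_of_snd (Finset.mem_of_mem_erase hf) (hDM he) h)
    · exact h2 e he (h ▸ (hVX f hf).1 hfX)
  have one_seller : ∀ e ∈ D, ∀ (X : Set β) (Y : Set σ), ClosedUnder V X Y → ClosedUnder N X Y →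
      (∀ f ∈ D, f.2 ∈ Y → f = e) → (∀ f ∈ D, f.1 ∉ X) →
      gainsFromTrade b s (edgesIn V X) ≤ gainsFromTrade b s (edgesIn N X) := by
    intro e he X Y hVX hNX h1 h2
    have hMN : edgesIn (M.erase e) X = edgesIn N X := by
      refine (edgesIn_mono fun f hf hfX => ?_).antisymm (edgesIn_mono fun f hf _ => ?_)
      · exact memN (Finset.mem_of_mem_erase hf) fun hfD => h2 f hfD hfX
      · exact Finset.mem_erase.2 ⟨fun h => N1 he f hf (h ▸ rfl), hNM hf⟩
    have hMX : ClosedUnder (M.erase e) X Y := fun f hf => by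
      have hf' := Finset.mem_erase.1 hf
      by_cases hfD : f ∈ D
      · exact iff_of_false (h2 f hfD) (fun h => hf'.1 (h1 f hfD h))
      · exact hNX f (memN hf'.2 hfD)
    rw [← hMN]
    refine gainsFromTrade_edgesIn_le (hM.subset (Finset.erase_subset _ _)) hV hMX hVX ?_
      (hDb e he)
    refine ((isMatchingIn_exchange (hM.subset (Finset.erase_subset _ _)) hV hMX
      hVX).removeBuyer fun f hf h => ?_).1
    rcases mem_exchange.1 hf with ⟨hf, _⟩ | ⟨hf, hfX⟩
    · exact (Finset.mem_erase.1 hf).1 (hM.eq_of_fst (Finset.mem_of_mem_erase hf) (hDM he) h)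
    · exact h2 e he (h ▸ hfX)
  -- Split off the alternating paths one after the other.
  have main : ∀ n (X : Set β) (Y : Set σ), X.ncard + Y.ncard = n → ClosedUnder V X Y →
      ClosedUnder N X Y →
      gainsFromTrade b s (edgesIn V X) ≤ gainsFromTrade b s (edgesIn N X) := by
    intro n
    induction n using Nat.strong_induction_on with
    | _ n ih =>
    intro X Y hn hVX hNX
    by_cases hex1 : ∃ e ∈ D, e.1 ∈ X
    · obtain ⟨e, he, heX⟩ := hex1
      obtain ⟨X', Y', h1, h2, h3, h4, h5⟩ := exists_closedUnder_of_buyer hV hN e.1 (N1 he)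
      have hno := nopath e he X' Y' h1 h2 h3 h4 h5
      rw [← gainsFromTrade_edgesIn_inter_add_diff b s V X X',
        ← gainsFromTrade_edgesIn_inter_add_diff b s N X X']
      refine add_le_add (one_buyer e he _ _ (hVX.inter h2) (hNX.inter h3) (fun f hf hfX => ?_)
        fun f hf hfY => hno f hf hfY.2) (ih _ ?_ _ _ rfl (hVX.diff h2) (hNX.diff h3))
      · by_contra hne
        obtain ⟨g, hg, hgf⟩ := h5 f.1 hfX.2 fun h => hne (hM.eq_of_fst (hDM hf) (hDM he) h)
        exact N1 hf g hg hgf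
      · have l1 : (X \ X').ncard < X.ncard :=
          Set.ncard_lt_ncard ⟨Set.sdiff_subset, fun h => (h heX).2 h1⟩ (Set.toFinite _)
        have l2 : (Y \ Y').ncard ≤ Y.ncard :=
          Set.ncard_le_ncard Set.sdiff_subset (Set.toFinite _)
        omega
    · by_cases hex2 : ∃ e ∈ D, e.2 ∈ Y
      · obtain ⟨e, he, heY⟩ := hex2
        obtain ⟨X', Y', h1, h2, h3, h5⟩ := exists_closedUnder_of_seller hV hN e.2 (N2 he)
        rw [← gainsFromTrade_edgesIn_inter_add_diff b s V X X',
          ← gainsFromTrade_edgesIn_inter_add_diff b s N X X']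
        refine add_le_add (one_seller e he _ _ (hVX.inter h2) (hNX.inter h3) (fun f hf hfY => ?_)
          fun f hf hfX => hex1 ⟨f, hf, hfX.1⟩) (ih _ ?_ _ _ rfl (hVX.diff h2) (hNX.diff h3))
        · by_contra hne
          obtain ⟨g, hg, hgf⟩ := h5 f.2 hfY.2 fun h => hne (hM.eq_of_snd (hDM hf) (hDM he) h)
          exact N2 hf g hg hgf
        · have l1 : (Y \ Y').ncard < Y.ncard :=
            Set.ncard_lt_ncard ⟨Set.sdiff_subset, fun h => (h heY).2 h1⟩ (Set.toFinite _)
          have l2 : (X \ X').ncard ≤ X.ncard :=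
            Set.ncard_le_ncard Set.sdiff_subset (Set.toFinite _)
          omega
      · push Not at hex1 hex2
        have hMN : edgesIn M X = edgesIn N X :=
          (edgesIn_mono fun f hf hfX => memN hf fun hfD => hex1 f hfD hfX).antisymm
            (edgesIn_mono fun f hf _ => hNM hf)
        have hMX : ClosedUnder M X Y := fun f hf => by
          by_cases hfD : f ∈ D
          · exact iff_of_false (hex1 f hfD) (hex2 f hfD)
          · exact hNX f (memN hf hfD)
        rw [← hMN]
        exact gainsFromTrade_edgesIn_le hM hV hMX hVX
          (isMatchingIn_exchange hM hV hMX hVX).1 hMopt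
  have huniv : ∀ W : Finset (β × σ), edgesIn W Set.univ = W := fun W => by
    ext
    simp [mem_edgesIn]
  have h := main _ Set.univ Set.univ rfl (fun _ _ => by simp) (fun _ _ => by simp)
  rwa [huniv, huniv] at h

/-- Buyers and sellers are complements: the two weights of optimal matchings that avoid `j` and `i`
respectively add up to no more than those of a matching that may use both and one that uses
neither.  Here `N₁` contains `i` and avoids `j`, and `N₂` contains `j` and avoids `i`. -/
theorem gainsFromTrade_add_le_of_complements {E N₁ N₂ : Finset (β × σ)} {b : β → ℝ} {s : σ → ℝ}
    {i : β} {j : σ} {w w₀ : ℝ} (h₁ : IsMatchingIn E N₁) (h₂ : IsMatchingIn E N₂)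
    (hj : ∀ e ∈ N₁, e.2 ≠ j) (hi : ∀ e ∈ N₂, e.1 ≠ i)
    (hw : ∀ N, IsMatchingIn E N → gainsFromTrade b s N ≤ w)
    (hw₀ : ∀ N, IsMatchingIn E N → (∀ e ∈ N, e.1 ≠ i) → (∀ e ∈ N, e.2 ≠ j) →
      gainsFromTrade b s N ≤ w₀) :
    gainsFromTrade b s N₁ + gainsFromTrade b s N₂ ≤ w + w₀ := by
  obtain ⟨X, Y, hiX, h1, h2, hY, -⟩ := exists_closedUnder_of_buyer h₁ h₂ i hi
  have hjY : j ∉ Y := fun h => by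
    obtain ⟨e, he, hej⟩ := hY j h
    exact hj e he hej
  have k1 := hw _ (isMatchingIn_exchange h₂ h₁ h2 h1)
  have k2 := hw₀ _ (isMatchingIn_exchange h₁ h₂ h1 h2) (fun e he h => by
      rcases mem_exchange.1 he with ⟨_, he⟩ | ⟨he, _⟩
      · exact he (h ▸ hiX)
      · exact hi e he h) (fun e he h => by
      rcases mem_exchange.1 he with ⟨he, _⟩ | ⟨he, heX⟩
      · exact hj e he h
      · exact hjY (h ▸ (h2 e he).1 heX))
  rw [gainsFromTrade_exchange] at k1 k2
  linarith

end Blocked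

/-! ### Slopes of the convex hull -/

section Hull

open Set

variable {H : ℝ → ℝ} {t : ℝ}

theorem convexEnvelope_le (hH : ∃ a c, IsAffineMinorant H a c) (ht : t ∈ Ioo (0 : ℝ) 1) :
    convexEnvelope H t ≤ H t := by
  obtain ⟨a, c, hac⟩ := hH
  refine csSup_le ⟨_, a, c, hac, rfl⟩ ?_
  rintro _ ⟨a', c', h, rfl⟩
  exact h t ht

theorem IsAffineMinorant.le_convexEnvelope {a c : ℝ} (h : IsAffineMinorant H a c)
    (ht : t ∈ Ioo (0 : ℝ) 1) : a * t + c ≤ convexEnvelope H t := by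
  refine le_csSup ⟨H t, ?_⟩ ⟨a, c, h, rfl⟩
  rintro _ ⟨a', c', h', rfl⟩
  exact h' t ht

theorem convexOn_convexEnvelope (hH : ∃ a c, IsAffineMinorant H a c) :
    ConvexOn ℝ (Ioo 0 1) (convexEnvelope H) := by
  refine ⟨convex_Ioo 0 1, fun x hx y hy p q hp hq hpq => ?_⟩
  obtain ⟨a, c, hac⟩ := hH
  refine csSup_le ⟨_, a, c, hac, rfl⟩ ?_
  rintro _ ⟨a', c', h, rfl⟩
  have h1 := mul_le_mul_of_nonneg_left (h.le_convexEnvelope hx) hp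
  have h2 := mul_le_mul_of_nonneg_left (h.le_convexEnvelope hy) hq
  simp only [smul_eq_mul]
  have h3 : c' = p * c' + q * c' := by rw [← add_mul, hpq, one_mul]
  linarith

/-- If `H t - c * t` is smaller somewhere to the right of `τ` than everywhere to the left of `τ`,
then the hull of `H` has slope less than `c` on the left of `τ`. -/
theorem derivWithin_Iio_convexEnvelope_lt (hH : ∃ a c, IsAffineMinorant H a c) {c τ y K : ℝ}
    (hτ : 0 < τ) (hτy : τ ≤ y) (hy : y < 1) (hK : H y - c * y < K)
    (h : ∀ t ∈ Ioo 0 τ, K ≤ H t - c * t) :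
    derivWithin (convexEnvelope H) (Iio τ) τ < c := by
  by_contra! hd
  have hconv := convexOn_convexEnvelope hH
  have hτ1 : τ ∈ Ioo (0 : ℝ) 1 := ⟨hτ, hτy.trans_lt hy⟩
  have hτ' : τ ∈ interior (Ioo (0 : ℝ) 1) := by rwa [interior_Ioo]
  set m := convexEnvelope H τ - c * τ with hm
  have hright : ∀ t ∈ Ico τ 1, m ≤ H t - c * t := by
    intro t ht
    have ht' : t ∈ Ioo (0 : ℝ) 1 := ⟨hτ.trans_le ht.1, ht.2⟩
    have hle := convexEnvelope_le hH ht'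
    rcases ht.1.eq_or_lt with rfl | hlt
    · linarith
    · have h1 := (hd.trans (hconv.leftDeriv_le_rightDeriv_of_mem_interior hτ')).trans
        (hconv.rightDeriv_le_slope_of_mem_interior hτ' ht' hlt)
      rw [slope_def_field, le_div_iff₀ (sub_pos.2 hlt)] at h1
      linarith
  have hmK : m < K := (hright y ⟨hτy, hy⟩).trans_lt hK
  -- To the left of `τ` there is room to tilt the supporting line at `τ`.
  set κ := (K - m) / τ with hκ
  have hκ0 : 0 < κ := div_pos (sub_pos.2 hmK) hτ
  have hκτ : κ * τ = K - m := div_mul_cancel₀ _ hτ.ne'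
  have hmin : IsAffineMinorant H (c - κ) (m + κ * τ) := by
    intro t ht
    rcases lt_or_ge t τ with hlt | hge
    · have := h t ⟨ht.1, hlt⟩
      have := mul_pos hκ0 ht.1
      linarith
    · have := hright t ⟨hge, ht.2⟩
      have := mul_le_mul_of_nonneg_left hge hκ0.le
      linarith
  have hle : derivWithin (convexEnvelope H) (Iio τ) τ ≤ c - κ := by
    rw [hconv.leftDeriv_eq_sSup_slope_of_mem_interior hτ']
    refine csSup_le (Set.Nonempty.image _ ⟨τ / 2, ⟨?_, ?_⟩, ?_⟩) ?_
    · linarith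
    · linarith [hτ1.2]
    · linarith
    · rintro _ ⟨t, ⟨ht, htτ⟩, rfl⟩
      have := hmin.le_convexEnvelope ht
      rw [slope_comm, slope_def_field, div_le_iff₀ (sub_pos.2 htτ)]
      linarith
  linarith

/-- If `H t - c * t` is smaller somewhere to the left of `τ` than everywhere to the right of `τ`,
then the hull of `H` has slope greater than `c` on the right of `τ`. -/
theorem lt_derivWithin_Ioi_convexEnvelope (hH : ∃ a c, IsAffineMinorant H a c) {c τ y K : ℝ}
    (hτ : τ < 1) (hyτ : y ≤ τ) (hy : 0 < y) (hK : H y - c * y < K)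
    (h : ∀ t ∈ Ioo τ 1, K ≤ H t - c * t) :
    c < derivWithin (convexEnvelope H) (Ioi τ) τ := by
  by_contra! hd
  have hconv := convexOn_convexEnvelope hH
  have hτ1 : τ ∈ Ioo (0 : ℝ) 1 := ⟨hy.trans_le hyτ, hτ⟩
  have hτ' : τ ∈ interior (Ioo (0 : ℝ) 1) := by rwa [interior_Ioo]
  set m := convexEnvelope H τ - c * τ with hm
  have hleft : ∀ t ∈ Ioc 0 τ, m ≤ H t - c * t := by
    intro t ht
    have ht' : t ∈ Ioo (0 : ℝ) 1 := ⟨ht.1, ht.2.trans_lt hτ⟩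
    have hle := convexEnvelope_le hH ht'
    rcases ht.2.eq_or_lt with rfl | hlt
    · linarith
    · have h1 := (hconv.slope_le_leftDeriv_of_mem_interior ht' hτ' hlt).trans
        ((hconv.leftDeriv_le_rightDeriv_of_mem_interior hτ').trans hd)
      rw [slope_def_field, div_le_iff₀ (sub_pos.2 hlt)] at h1
      linarith
  have hmK : m < K := (hleft y ⟨hy, hyτ⟩).trans_lt hK
  have hτ0 : 0 < 1 - τ := sub_pos.2 hτ
  set κ := (K - m) / (1 - τ) with hκ
  have hκ0 : 0 < κ := div_pos (sub_pos.2 hmK) hτ0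
  have hκτ : κ * (1 - τ) = K - m := div_mul_cancel₀ _ hτ0.ne'
  have hmin : IsAffineMinorant H (c + κ) (m - κ * τ) := by
    intro t ht
    rcases lt_or_ge τ t with hlt | hge
    · have := h t ⟨hlt, ht.2⟩
      have := mul_lt_mul_of_pos_left ht.2 hκ0
      linarith
    · have := hleft t ⟨ht.1, hge⟩
      have := mul_le_mul_of_nonneg_left hge hκ0.le
      linarith
  have hle : c + κ ≤ derivWithin (convexEnvelope H) (Ioi τ) τ := by
    rw [hconv.rightDeriv_eq_sInf_slope_of_mem_interior hτ']
    refine le_csInf (Set.Nonempty.image _ ⟨(τ + 1) / 2, ⟨?_, ?_⟩, ?_⟩) ?_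
    · linarith [hτ1.1]
    · linarith
    · linarith
    · rintro _ ⟨t, ⟨ht, htτ⟩, rfl⟩
      have := hmin.le_convexEnvelope ht
      rw [slope_def_field, le_div_iff₀ (sub_pos.2 htτ)]
      linarith
  linarith

end Hull

/-! ### Quantiles -/

section Quantile

open Set Filter Topology

variable {D : Measure ℝ} [IsProbabilityMeasure D]

theorem cdf_eq_zero_of_neg (hD : D (Iio 0) = 0) {x : ℝ} (hx : x < 0) : cdf D x = 0 := by
  rw [cdf_eq_real, measureReal_def, measure_mono_null (Iic_subset_Iio.2 hx) hD,
    ENNReal.toReal_zero]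

theorem quantile_le_iff (hD : D (Iio 0) = 0) {t : ℝ} (ht : t ∈ Ioo (0 : ℝ) 1) (x : ℝ) :
    quantile D t ≤ x ↔ t ≤ cdf D x := by
  -- Without this lower bound, the infimum in `quantile` would have the junk value `0`.
  have hbdd : BddBelow {x : ℝ | t ≤ cdf D x} := by
    refine ⟨0, fun y hy => ?_⟩
    by_contra! hneg
    have hy' : t ≤ cdf D y := hy
    rw [cdf_eq_zero_of_neg hD hneg] at hy'
    linarith [ht.1]
  have hne : {x : ℝ | t ≤ cdf D x}.Nonempty :=
    (((tendsto_cdf_atTop D).eventually (lt_mem_nhds ht.2)).exists).imp fun _ h => le_of_lt h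
  refine ⟨fun h => ?_, fun h => csInf_le hbdd h⟩
  have hq : t ≤ cdf D (quantile D t) := by
    have hr : Tendsto (cdf D) (𝓝[>] (quantile D t)) (𝓝 (cdf D (quantile D t))) :=
      ((cdf D).right_continuous _).tendsto.mono_left (nhdsWithin_mono _ Ioi_subset_Ici_self)
    refine ge_of_tendsto hr (eventually_mem_nhdsWithin.mono fun x hx => ?_)
    obtain ⟨y, hy, hyx⟩ := exists_lt_of_csInf_lt hne hx
    exact le_trans hy (monotone_cdf D hyx.le)
  exact hq.trans (monotone_cdf D h)

theorem measureReal_Ioi_eq (x : ℝ) : D.real (Ioi x) = 1 - cdf D x := by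
  rw [cdf_eq_real, ← compl_Iic, probReal_compl_eq_one_sub measurableSet_Iic]

theorem one_sub_le_measureReal_Ici {q t : ℝ} (h : ∀ x < q, cdf D x ≤ t) :
    1 - t ≤ D.real (Ici q) := by
  have h1 : D.real (Iio q) ≤ max t 0 := by
    have h2 := (cdf D).measure_Iio (tendsto_cdf_atBot D) q
    rw [measure_cdf, sub_zero] at h2
    rw [measureReal_def, h2, ENNReal.toReal_ofReal']
    refine max_le_max_right 0 ?_
    exact le_of_tendsto ((monotone_cdf D).tendsto_leftLim q)
      (eventually_mem_nhdsWithin.mono fun x hx => h x hx)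
  have h0 : 0 ≤ t := (cdf_nonneg D _).trans (h (q - 1) (by linarith))
  rw [max_eq_left h0] at h1
  rw [← compl_Iio, probReal_compl_eq_one_sub measurableSet_Iio]
  linarith

theorem cdf_pos_of_mem_support {v x : ℝ} (hv : v ∈ D.support) (h : v < x) : 0 < cdf D x := by
  rw [cdf_eq_real]
  exact ENNReal.toReal_pos ((Measure.mem_support_iff_forall v).1 hv _ (Iic_mem_nhds h)).ne'
    (measure_ne_top _ _)

theorem cdf_lt_one_of_mem_support {v x : ℝ} (hv : v ∈ D.support) (h : x < v) : cdf D x < 1 := by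
  have h1 : 0 < D.real (Ioi x) :=
    ENNReal.toReal_pos ((Measure.mem_support_iff_forall v).1 hv _ (Ioi_mem_nhds h)).ne'
      (measure_ne_top _ _)
  rw [measureReal_Ioi_eq] at h1
  linarith

end Quantile

/-! ### Offers and ironed virtual values -/

section Ironed

open Set Filter Topology

variable {D : Measure ℝ} [IsProbabilityMeasure D]

/-- If the ironed virtual value at `v` is at least the cost `s`, then prices above `v` are no better
for the seller than the prices between `s` and `v`: otherwise the hull of the negated revenue
curve would have slope less than `s` just above `v`. -/
theorem sellerUtility_le_of_le_ironedVirtualValue (hD : D (Iio 0) = 0) {s v K : ℝ}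
    (hv : v ∈ D.support) (hsv : s ≤ v) (h : (s : EReal) ≤ ironedVirtualValue D v)
    (hK : ∀ p ∈ Icc s v, sellerUtility D s p ≤ K) {p : ℝ} (hp : v < p) :
    sellerUtility D s p ≤ K := by
  by_contra! hlt
  unfold ironedVirtualValue at h
  split_ifs at h with hex
  swap
  · exact absurd h (by simp)
  set δ := sellerUtility D s p - K with hδ
  have hδ0 : 0 < δ := sub_pos.2 hlt
  have hKv := hK v ⟨hsv, le_rfl⟩
  have hv0 : 0 ≤ sellerUtility D s v := mul_nonneg (sub_nonneg.2 hsv) measureReal_nonneg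
  have hps : 0 < p - s := by linarith
  -- Moving the price from `v` up to `w` changes the utility by at most `δ / 2` if the probability
  -- of acceptance stays that at `v`; this covers the quantiles between `v` and `w`.
  obtain ⟨w, hvw, hw⟩ : ∃ w, v < w ∧ w < min p (v + δ / 2) :=
    exists_between (lt_min hp (by linarith))
  have hwp := hw.trans_le (min_le_left _ _)
  have hwδ := hw.trans_le (min_le_right _ _)
  -- The level `y` is slightly above the probability of a value below `p`, so that its quantile is
  -- at least `p` and selling with probability `1 - y` at the price `p` costs only `δ / 4`.
  set ε := δ / 4 / (p - s) with hε
  have hε0 : 0 < ε := by positivity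
  have hεp : ε * (p - s) = δ / 4 := div_mul_cancel₀ _ hps.ne'
  set y := 1 - D.real (Ici p) + ε with hy
  have hup : sellerUtility D s p = (p - s) * D.real (Ici p) := rfl
  have hy1 : y < 1 := by
    have h1 : 0 < (p - s) * (1 - y) := by
      have : (p - s) * (1 - y) = sellerUtility D s p - δ / 4 := by rw [hup, ← hεp, hy]; ring
      rw [this]
      linarith
    linarith [pos_of_mul_pos_right h1 hps.le]
  have hcdf : ∀ x < p, cdf D x < y := by
    intro x hx
    have h1 : D.real (Ici p) ≤ D.real (Ioi x) :=
      measureReal_mono (fun z hz => lt_of_lt_of_le hx hz)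
    rw [measureReal_Ioi_eq] at h1
    linarith
  have hτ0 : 0 < cdf D w := cdf_pos_of_mem_support hv hvw
  have hyI : y ∈ Ioo (0 : ℝ) 1 := ⟨hτ0.trans (hcdf w hwp), hy1⟩
  have hQy : p ≤ quantile D y := by
    by_contra! hq
    exact absurd ((quantile_le_iff hD hyI _).1 le_rfl) (not_le.2 (hcdf _ hq))
  refine absurd (h.trans (iInf_le _ ⟨w, hvw⟩)) (not_le.2 (EReal.coe_lt_coe_iff.2 ?_))
  refine derivWithin_Iio_convexEnvelope_lt hex (y := y) (K := -(K + δ / 2) - s) hτ0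
    (hcdf w hwp).le hy1 ?_ fun t ht => ?_
  · have h1 : (1 - y) * (p - s) ≤ (1 - y) * (quantile D y - s) :=
      mul_le_mul_of_nonneg_left (by linarith) (by linarith)
    have h2 : (1 - y) * (p - s) = sellerUtility D s p - δ / 4 := by rw [hup, ← hεp, hy]; ring
    unfold negRevenueCurve
    linarith
  · have htI : t ∈ Ioo (0 : ℝ) 1 := ⟨ht.1, ht.2.trans_le (cdf_le_one D w)⟩
    have hQw : quantile D t ≤ w := (quantile_le_iff hD htI w).2 ht.2.le
    have ht1 : 0 ≤ 1 - t := by linarith [htI.2]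
    suffices hsuff : (1 - t) * (quantile D t - s) ≤ K + δ / 2 by
      unfold negRevenueCurve
      linarith
    rcases le_total (quantile D t) s with hQ | hQ
    · have := mul_nonneg ht1 (sub_nonneg.2 hQ)
      linarith
    rcases le_or_gt (quantile D t) v with hQv | hQv
    · have h1 : 1 - t ≤ D.real (Ici (quantile D t)) :=
        one_sub_le_measureReal_Ici fun x hx => by
          by_contra! hcon
          exact absurd ((quantile_le_iff hD htI x).2 hcon.le) (not_le.2 hx)
      have h2 := mul_le_mul_of_nonneg_right h1 (sub_nonneg.2 hQ)
      have h3 := hK _ ⟨hQ, hQv⟩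
      unfold sellerUtility at h3
      linarith
    · have h1 : 1 - t ≤ D.real (Ici v) := one_sub_le_measureReal_Ici fun x hx => by
        by_contra! hcon
        exact absurd ((quantile_le_iff hD htI x).2 hcon.le) (not_le.2 (hx.trans hQv))
      have h2 : D.real (Ici v) ≤ 1 := measureReal_le_one
      have h3 : (1 - t) * (quantile D t - s) ≤ D.real (Ici v) * (w - s) :=
        mul_le_mul h1 (by linarith) (by linarith) measureReal_nonneg
      have h4 : D.real (Ici v) * (w - v) ≤ 1 * (w - v) :=
        mul_le_mul_of_nonneg_right h2 (by linarith)
      unfold sellerUtility at hKv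
      linarith

theorem isAffineMinorant_costCurve (hD : D (Iio 0) = 0) : IsAffineMinorant (costCurve D) 0 0 := by
  intro t ht
  have h : 0 ≤ quantile D t := by
    by_contra! hq
    have h1 := (quantile_le_iff hD ht _).1 le_rfl
    rw [cdf_eq_zero_of_neg hD hq] at h1
    linarith [ht.1]
  simpa [costCurve] using mul_nonneg ht.1.le h

/-- If the ironed virtual cost at `x` is at most the value `b`, then prices below `x` are no better
for the buyer than the prices between `x` and `b`. -/
theorem buyerUtility_le_of_ironedVirtualCost_le (hD : D (Iio 0) = 0) {b x K : ℝ}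
    (hx : x ∈ D.support) (hxb : x ≤ b) (h : ironedVirtualCost D x ≤ (b : EReal))
    (hK : ∀ p ∈ Icc x b, buyerUtility D b p ≤ K) {p : ℝ} (hp : p < x) :
    buyerUtility D b p ≤ K := by
  by_contra! hlt
  unfold ironedVirtualCost at h
  set δ := buyerUtility D b p - K with hδ
  have hδ0 : 0 < δ := sub_pos.2 hlt
  have hKx := hK x ⟨le_rfl, hxb⟩
  have hx0 : 0 ≤ buyerUtility D b x := mul_nonneg (sub_nonneg.2 hxb) measureReal_nonneg
  -- Moving the price from `x` down to `w` changes the utility by at most `δ / 2` if the probability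
  -- of acceptance stays that at `x`; this covers the quantiles between `w` and `x`.
  obtain ⟨w, hw, hwx⟩ : ∃ w, max p (x - δ / 2) < w ∧ w < x :=
    exists_between (max_lt hp (by linarith))
  have hpw := (le_max_left _ _).trans_lt hw
  have hδw := (le_max_right _ _).trans_lt hw
  have hup : buyerUtility D b p = (b - p) * cdf D p := by rw [cdf_eq_real]; rfl
  have hy0 : 0 < cdf D p := by
    have h1 : 0 < (b - p) * cdf D p := by linarith
    exact pos_of_mul_pos_right h1 (by linarith)
  have hτ1 : cdf D w < 1 := cdf_lt_one_of_mem_support hx hwx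
  have hpτ : cdf D p ≤ cdf D w := monotone_cdf D hpw.le
  refine absurd ((le_iSup (fun w : Iio x => ((derivWithin (convexEnvelope (costCurve D))
    (Set.Ioi (cdf D (w : ℝ))) (cdf D (w : ℝ)) : ℝ) : EReal)) ⟨w, hwx⟩).trans h)
    (not_le.2 (EReal.coe_lt_coe_iff.2 ?_))
  refine lt_derivWithin_Ioi_convexEnvelope ⟨0, 0, isAffineMinorant_costCurve hD⟩ (y := cdf D p)
    (K := -(K + δ / 2)) hτ1 hpτ hy0 ?_ fun t ht => ?_
  · have hQ : quantile D (cdf D p) ≤ p :=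
      (quantile_le_iff hD ⟨hy0, hpτ.trans_lt hτ1⟩ p).2 le_rfl
    have h1 := mul_le_mul_of_nonneg_left hQ hy0.le
    unfold costCurve
    linarith
  · have htI : t ∈ Ioo (0 : ℝ) 1 := ⟨(hy0.trans_le hpτ).trans ht.1, ht.2⟩
    have hQw : w < quantile D t := by
      by_contra! hcon
      exact absurd ((quantile_le_iff hD htI w).1 hcon) (not_le.2 ht.1)
    suffices hsuff : t * (b - quantile D t) ≤ K + δ / 2 by
      unfold costCurve
      linarith
    rcases le_total b (quantile D t) with hQ | hQ
    · have := mul_nonneg htI.1.le (sub_nonneg.2 hQ)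
      linarith
    rcases le_or_gt x (quantile D t) with hQx | hQx
    · have h1 : t ≤ D.real (Iic (quantile D t)) := by
        rw [← cdf_eq_real]
        exact (quantile_le_iff hD htI _).1 le_rfl
      have h2 := mul_le_mul_of_nonneg_right h1 (sub_nonneg.2 hQ)
      have h3 := hK _ ⟨hQx, hQ⟩
      unfold buyerUtility at h3
      linarith
    · have h1 : t ≤ D.real (Iic x) := by
        rw [← cdf_eq_real]
        exact (quantile_le_iff hD htI _).1 hQx.le
      have h2 : D.real (Iic x) ≤ 1 := measureReal_le_one
      have h3 : t * (b - quantile D t) ≤ D.real (Iic x) * (b - w) :=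
        mul_le_mul h1 (by linarith) (by linarith) measureReal_nonneg
      have h4 : D.real (Iic x) * (x - w) ≤ 1 * (x - w) :=
        mul_le_mul_of_nonneg_right h2 (by linarith)
      unfold buyerUtility at hKx
      linarith

theorem ironedVirtualValue_ne_top (D : Measure ℝ) (v : ℝ) : ironedVirtualValue D v ≠ ⊤ := by
  unfold ironedVirtualValue
  split_ifs
  · exact ((iInf_le _ (⟨v + 1, by simp⟩ : Ioi v)).trans_lt (EReal.coe_lt_top _)).ne
  · simp

theorem ironedVirtualCost_ne_bot (D : Measure ℝ) (x : ℝ) : ironedVirtualCost D x ≠ ⊥ := by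
  unfold ironedVirtualCost
  exact ((EReal.bot_lt_coe _).trans_le (le_iSup (fun w : Iio x =>
    ((derivWithin (convexEnvelope (costCurve D))
    (Set.Ioi (cdf D (w : ℝ))) (cdf D (w : ℝ)) : ℝ) : EReal)) ⟨x - 1, by simp⟩)).ne'

end Ironed

/-! ### Existence of offers -/

section Offers

open Set Filter Topology

/-- An upper semicontinuous function has a compact set of maximizers on a compact interval. -/
theorem exists_isCompact_maximizers {u : ℝ → ℝ} {a c : ℝ} (hac : a ≤ c)
    (hu : UpperSemicontinuousOn u (Icc a c)) :
    ∃ S ⊆ Icc a c, IsCompact S ∧ S.Nonempty ∧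
      (∀ p ∈ S, ∀ q ∈ Icc a c, u q ≤ u p) ∧ ∀ p ∈ Icc a c, ∀ q ∈ S, u q ≤ u p → p ∈ S := by
  obtain ⟨m, hm, hmax⟩ := hu.exists_isMaxOn (nonempty_Icc.2 hac) isCompact_Icc
  refine ⟨Icc a c ∩ u ⁻¹' Ici (u m), inter_subset_left,
    hu.isCompact_inter_preimage_Ici isCompact_Icc _, ⟨m, hm, le_refl (u m)⟩,
    fun p hp q hq => (hmax hq).trans hp.2, fun p hp q hq hqp => ⟨hp, le_trans hq.2 hqp⟩⟩

theorem exists_isLeast_maximizers {u : ℝ → ℝ} {A : Set ℝ} {a c : ℝ} (hac : a ≤ c)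
    (hu : UpperSemicontinuousOn u (Icc a c)) (hA : Icc a c ⊆ A)
    (hlow : ∀ p < a, ∀ q ∈ Icc a c, u p < u q)
    (hhigh : ∀ K, (∀ q ∈ Icc a c, u q ≤ K) → ∀ p ∈ A, c < p → u p ≤ K) :
    ∃ p ≤ c, IsLeast {p | p ∈ A ∧ ∀ q ∈ A, u q ≤ u p} p := by
  obtain ⟨S, hSI, hSc, hSn, hSmax, hS⟩ := exists_isCompact_maximizers hac hu
  obtain ⟨p, hp, hleast⟩ := hSc.exists_isLeast hSn
  refine ⟨p, (hSI hp).2, ⟨hA (hSI hp), fun q hq => ?_⟩, fun q hq => ?_⟩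
  · rcases lt_or_ge q a with hqa | hqa
    · exact (hlow q hqa p (hSI hp)).le
    · rcases lt_or_ge c q with hcq | hcq
      · exact hhigh _ (hSmax p hp) q hq hcq
      · exact hSmax p hp q ⟨hqa, hcq⟩
  · have hpq := hq.2 p (hA (hSI hp))
    rcases lt_or_ge q a with hqa | hqa
    · exact absurd hpq (not_le.2 (hlow q hqa p (hSI hp)))
    · rcases lt_or_ge c q with hcq | hcq
      · exact (hSI hp).2.trans hcq.le
      · exact hleast (hS q ⟨hqa, hcq⟩ p hp hpq)

theorem exists_isGreatest_maximizers {u : ℝ → ℝ} {A : Set ℝ} {a c : ℝ} (hac : a ≤ c)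
    (hu : UpperSemicontinuousOn u (Icc a c)) (hA : Icc a c ⊆ A)
    (hhigh : ∀ p > c, ∀ q ∈ Icc a c, u p < u q)
    (hlow : ∀ K, (∀ q ∈ Icc a c, u q ≤ K) → ∀ p ∈ A, p < a → u p ≤ K) :
    ∃ p ≥ a, IsGreatest {p | p ∈ A ∧ ∀ q ∈ A, u q ≤ u p} p := by
  obtain ⟨S, hSI, hSc, hSn, hSmax, hS⟩ := exists_isCompact_maximizers hac hu
  obtain ⟨p, hp, hgreatest⟩ := hSc.exists_isGreatest hSn
  refine ⟨p, (hSI hp).1, ⟨hA (hSI hp), fun q hq => ?_⟩, fun q hq => ?_⟩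
  · rcases lt_or_ge c q with hcq | hcq
    · exact (hhigh q hcq p (hSI hp)).le
    · rcases lt_or_ge q a with hqa | hqa
      · exact hlow _ (hSmax p hp) q hq hqa
      · exact hSmax p hp q ⟨hqa, hcq⟩
  · have hpq := hq.2 p (hA (hSI hp))
    rcases lt_or_ge c q with hcq | hcq
    · exact absurd hpq (not_le.2 (hhigh q hcq p (hSI hp)))
    · rcases lt_or_ge q a with hqa | hqa
      · exact hqa.le.trans (hSI hp).1
      · exact hgreatest (hS q ⟨hqa, hcq⟩ p hp hpq)

theorem upperSemicontinuousOn_mul {f g : ℝ → ℝ} {S : Set ℝ} (hf : ContinuousOn f S)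
    (hf0 : ∀ x ∈ S, 0 ≤ f x) (hg : UpperSemicontinuous g) :
    UpperSemicontinuousOn (fun x => f x * g x) S := by
  intro x hx y hy
  have hcont : Tendsto (fun η => f x * (g x + η)) (𝓝[>] 0) (𝓝 (f x * (g x + 0))) :=
    ((continuous_const.mul (continuous_const.add continuous_id)).tendsto _).mono_left
      nhdsWithin_le_nhds
  rw [add_zero] at hcont
  obtain ⟨η, hηy, hη⟩ := ((hcont.eventually (gt_mem_nhds hy)).and self_mem_nhdsWithin).exists
  have h1 : ∀ᶠ x' in 𝓝[S] x, g x' < g x + η :=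
    (hg x (g x + η) (lt_add_of_pos_right _ hη)).filter_mono nhdsWithin_le_nhds
  have h2 : ∀ᶠ x' in 𝓝[S] x, f x' * (g x + η) < y :=
    ((hf x hx).mul tendsto_const_nhds).eventually (gt_mem_nhds hηy)
  filter_upwards [h1, h2, self_mem_nhdsWithin] with x' h1 h2 hx'
  exact (mul_le_mul_of_nonneg_left h1.le (hf0 x' hx')).trans_lt h2

theorem upperSemicontinuous_measureReal_Iic (D : Measure ℝ) [IsFiniteMeasure D] :
    UpperSemicontinuous fun p => D.real (Iic p) := by
  intro p y hy
  have h := tendsto_measure_biInter_gt (μ := D) (s := fun r : ℝ => Iic r) (a := p)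
    (fun _ _ => measurableSet_Iic.nullMeasurableSet) (fun _ _ _ h => Iic_subset_Iic.2 h)
    ⟨p + 1, by simp, measure_ne_top _ _⟩
  have hI : (⋂ r > p, Iic r) = Iic p := by
    ext x
    simp only [gt_iff_lt, mem_iInter, mem_Iic]
    exact ⟨fun h => le_of_forall_gt_imp_ge_of_dense h, fun h r hr => h.trans hr.le⟩
  rw [hI] at h
  have h' := (ENNReal.tendsto_toReal (measure_ne_top D _)).comp h
  obtain ⟨q, hq, hpq⟩ := ((h'.eventually (gt_mem_nhds hy)).and self_mem_nhdsWithin).exists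
  filter_upwards [Iio_mem_nhds hpq] with x hx
  exact (measureReal_mono (Iic_subset_Iic.2 (le_of_lt hx))).trans_lt hq

theorem upperSemicontinuous_measureReal_Ici (D : Measure ℝ) [IsFiniteMeasure D] :
    UpperSemicontinuous fun p => D.real (Ici p) := by
  intro p y hy
  have h := tendsto_measure_biInter_gt (μ := D) (s := fun r : ℝ => Ici (-r)) (a := -p)
    (fun _ _ => measurableSet_Ici.nullMeasurableSet)
    (fun _ _ _ h => Ici_subset_Ici.2 (neg_le_neg h)) ⟨-p + 1, by simp, measure_ne_top _ _⟩
  have hI : (⋂ r > -p, Ici (-r)) = Ici p := by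
    ext x
    simp only [gt_iff_lt, mem_iInter, mem_Ici]
    refine ⟨fun h => le_of_forall_lt_imp_le_of_dense fun r hr => ?_, fun h r hr => ?_⟩
    · simpa using h (-r) (by linarith)
    · linarith
  rw [hI] at h
  have h' := (ENNReal.tendsto_toReal (measure_ne_top D _)).comp h
  obtain ⟨q, hq, hpq⟩ := ((h'.eventually (gt_mem_nhds hy)).and self_mem_nhdsWithin).exists
  have hpq' : -q < p := by linarith [show -p < q from hpq]
  filter_upwards [Ioi_mem_nhds hpq'] with x hx
  exact (measureReal_mono (Ici_subset_Ici.2 (le_of_lt hx))).trans_lt hq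

/-- The seller's optimal offer exists and is at most `c` if the prices above `c` are no better than
those between her cost `s` and `c`. -/
theorem exists_isSellerOffer {D : Measure ℝ} [IsFiniteMeasure D] {s c : ℝ} {sbar : EReal}
    (hsc : s ≤ c) (hc : (c : EReal) ≤ sbar) (hpos : ∀ p < s, 0 < D.real (Ici p))
    (hhigh : ∀ K, (∀ q ∈ Icc s c, sellerUtility D s q ≤ K) → ∀ p : ℝ, (p : EReal) ≤ sbar → c < p →
      sellerUtility D s p ≤ K) : ∃ p ≤ c, IsSellerOffer D s sbar p := by
  refine exists_isLeast_maximizers (A := {p : ℝ | (p : EReal) ≤ sbar}) hsc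
    (upperSemicontinuousOn_mul (by fun_prop) (fun x hx => sub_nonneg.2 hx.1)
      (upperSemicontinuous_measureReal_Ici D))
    (fun p hp => le_trans (EReal.coe_le_coe_iff.2 hp.2) hc) (fun p hp q hq => ?_) hhigh
  exact (mul_neg_of_neg_of_pos (sub_neg.2 hp) (hpos p hp)).trans_le
    (mul_nonneg (sub_nonneg.2 hq.1) measureReal_nonneg)

/-- The buyer's optimal offer exists and is at least `a` if the prices below `a` are no better than
those between `a` and her value `b`. -/
theorem exists_isBuyerOffer {D : Measure ℝ} [IsFiniteMeasure D] {a b bbar : ℝ}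
    (hab : a ≤ b) (ha : bbar ≤ a) (hpos : ∀ p > b, 0 < D.real (Iic p))
    (hlow : ∀ K, (∀ q ∈ Icc a b, buyerUtility D b q ≤ K) → ∀ p : ℝ, bbar ≤ p → p < a →
      buyerUtility D b p ≤ K) : ∃ p ≥ a, IsBuyerOffer D b bbar p := by
  refine exists_isGreatest_maximizers (A := {p : ℝ | bbar ≤ p}) hab
    (upperSemicontinuousOn_mul (by fun_prop) (fun x hx => sub_nonneg.2 hx.2)
      (upperSemicontinuous_measureReal_Iic D))
    (fun p hp => ha.trans hp.1) (fun p hp q hq => ?_) hlow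
  exact (mul_neg_of_neg_of_pos (sub_neg.2 hp) (hpos p hp)).trans_le
    (mul_nonneg (sub_nonneg.2 hq.2) measureReal_nonneg)

end Offers

/-! ### Trade on a single edge -/

section Edge

open Set

variable {Db Ds : Measure ℝ} [IsProbabilityMeasure Db] [IsProbabilityMeasure Ds]
  {b s bbar : ℝ} {sbar : EReal}

theorem measurableSet_coe_le (x : EReal) : MeasurableSet {y : ℝ | (y : EReal) ≤ x} :=
  measurableSet_le measurable_coe_real_ereal measurable_const

theorem measureReal_cond {D : Measure ℝ} {A : Set ℝ} (hA : MeasurableSet A) (B : Set ℝ) :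
    (cond D A).real B = (D.real A)⁻¹ * D.real (A ∩ B) := by
  rw [measureReal_def, cond_apply hA, ENNReal.toReal_mul, ENNReal.toReal_inv]
  rfl

theorem measureReal_cond_pos {D : Measure ℝ} [IsFiniteMeasure D] {A B : Set ℝ}
    (hA : MeasurableSet A) (hAB : D (A ∩ B) ≠ 0) : 0 < (cond D A).real B :=
  ENNReal.toReal_pos (cond_pos_of_inter_ne_zero hA hAB).ne' (measure_ne_top _ _)

theorem measure_ne_zero_of_mem_support {D : Measure ℝ} {x : ℝ} (hx : x ∈ D.support) {A : Set ℝ}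
    (hA : A ∈ nhds x) : D A ≠ 0 := ((Measure.mem_support_iff_forall x).1 hx A hA).ne'

theorem measureReal_cond_Ici_pos (hb : b ∈ Db.support) (hsb : s ≤ b)
    (hnull : Db (Ici bbar) ≠ 0) : ∀ p < s, 0 < (cond Db (Ici bbar)).real (Ici p) := by
  intro p hp
  refine measureReal_cond_pos measurableSet_Ici ?_
  rcases le_total p bbar with h | h
  · rwa [inter_eq_left.2 (Ici_subset_Ici.2 h)]
  · rw [inter_eq_right.2 (Ici_subset_Ici.2 h)]
    exact measure_ne_zero_of_mem_support hb (Ici_mem_nhds (hp.trans_le hsb))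

theorem measureReal_cond_Iic_pos (hs : s ∈ Ds.support) (hsb : s ≤ b)
    (hnull : Ds {x : ℝ | (x : EReal) ≤ sbar} ≠ 0) :
    ∀ p > b, 0 < (cond Ds {x : ℝ | (x : EReal) ≤ sbar}).real (Iic p) := by
  intro p hp
  refine measureReal_cond_pos (measurableSet_coe_le _) ?_
  rcases le_total (p : EReal) sbar with h | h
  · have hsub : Iic p ⊆ {x : ℝ | (x : EReal) ≤ sbar} := fun x hx =>
      le_trans (EReal.coe_le_coe_iff.2 hx) h
    rw [inter_eq_right.2 hsub]
    exact measure_ne_zero_of_mem_support hs (Iic_mem_nhds (hsb.trans_lt hp))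
  · have hsub : {x : ℝ | (x : EReal) ≤ sbar} ⊆ Iic p := fun x hx =>
      EReal.coe_le_coe_iff.1 (le_trans hx h)
    rwa [inter_eq_left.2 hsub]

/-- A seller who may not ask for more than the buyer's value `b` trades, as long as her target
distribution is well defined. -/
theorem soTrades_of_sbar_le (hb : b ∈ Db.support) (hsb : s ≤ b) (hs : (s : EReal) ≤ sbar)
    (hnull : Db (Ici bbar) ≠ 0) (h : sbar ≤ b) : SOTrades sbar (cond Db (Ici bbar)) b s := by
  lift sbar to ℝ using
    ⟨(h.trans_lt (EReal.coe_lt_top b)).ne, ((EReal.bot_lt_coe s).trans_le hs).ne'⟩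
  obtain ⟨p, hp, hoffer⟩ := exists_isSellerOffer (EReal.coe_le_coe_iff.1 hs) le_rfl
    (measureReal_cond_Ici_pos hb hsb hnull)
    fun K _ p hp hlt => absurd (EReal.coe_le_coe_iff.1 hp) (not_le.2 hlt)
  exact ⟨p, hoffer, hp.trans (EReal.coe_le_coe_iff.1 h)⟩

/-- A buyer who may not offer less than the seller's cost `s` trades, as long as her target
distribution is well defined. -/
theorem boTrades_of_le_bbar (hs : s ∈ Ds.support) (hsb : s ≤ b) (hb : bbar ≤ b)
    (hnull : Ds {x : ℝ | (x : EReal) ≤ sbar} ≠ 0) (h : s ≤ bbar) :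
    BOTrades bbar (cond Ds {x : ℝ | (x : EReal) ≤ sbar}) b s := by
  obtain ⟨p, hp, hoffer⟩ := exists_isBuyerOffer hb le_rfl
    (measureReal_cond_Iic_pos hs hsb hnull)
    fun K _ p hp hlt => absurd hp (not_le.2 hlt)
  exact ⟨p, hoffer, h.trans hp⟩

/-- If one of the two offer constraints already forces trade, one of the two offers leads to
trade.  Should one of the two conditioning events be null, then the other one is not, because
`bbar ≤ sbar` and `s < b`. -/
theorem trades_of_constraint (hb : b ∈ Db.support) (hs : s ∈ Ds.support) (hsb : s < b)
    (hbbar : bbar ≤ b) (hsbar : (s : EReal) ≤ sbar) (hbs : (bbar : EReal) ≤ sbar)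
    (h : sbar ≤ b ∨ s ≤ bbar) :
    SOTrades sbar (cond Db (Ici bbar)) b s ∨
      BOTrades bbar (cond Ds {x : ℝ | (x : EReal) ≤ sbar}) b s := by
  have hnb : Db (Ici bbar) = 0 → bbar = b := fun h0 => by
    by_contra hne
    exact measure_ne_zero_of_mem_support hb (Ici_mem_nhds (hbbar.lt_of_ne hne)) h0
  have hns : Ds {x : ℝ | (x : EReal) ≤ sbar} = 0 → sbar = s := fun h0 => by
    by_contra hne
    have hlt : (s : EReal) < sbar := hsbar.lt_of_ne (Ne.symm hne)
    have hmem : {x : ℝ | (x : EReal) ≤ sbar} ∈ nhds s :=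
      (continuous_coe_real_ereal.tendsto s).eventually (Iic_mem_nhds hlt)
    exact measure_ne_zero_of_mem_support hs hmem h0
  by_cases h1 : Db (Ici bbar) = 0
  · by_cases h2 : Ds {x : ℝ | (x : EReal) ≤ sbar} = 0
    · rw [hns h2, hnb h1, EReal.coe_le_coe_iff] at hbs
      exact absurd hbs (not_le.2 hsb)
    · exact Or.inr (boTrades_of_le_bbar hs hsb.le hbbar h2 (hnb h1 ▸ hsb.le))
  · by_cases h2 : sbar ≤ b
    · exact Or.inl (soTrades_of_sbar_le hb hsb.le hsbar h1 h2)
    · refine Or.inr (boTrades_of_le_bbar hs hsb.le hbbar (fun h0 => h2 ?_)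
        (h.resolve_left h2))
      rw [hns h0]
      exact EReal.coe_le_coe_iff.2 hsb.le

theorem soTrades_of_le_ironedVirtualValue (hDb : Db (Iio 0) = 0) (hb : b ∈ Db.support)
    (hsb : s < b) (h1 : bbar < s) (h2 : (b : EReal) < sbar)
    (h : (s : EReal) ≤ ironedVirtualValue Db b) : SOTrades sbar (cond Db (Ici bbar)) b s := by
  have hnull : Db (Ici bbar) ≠ 0 :=
    measure_ne_zero_of_mem_support hb (Ici_mem_nhds (h1.trans hsb))
  have hκ : 0 < (Db.real (Ici bbar))⁻¹ :=
    inv_pos.2 (ENNReal.toReal_pos hnull (measure_ne_top _ _))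
  -- Conditioning only rescales the utility from prices above the cost.
  have hu : ∀ p, s ≤ p → sellerUtility (cond Db (Ici bbar)) s p =
      (Db.real (Ici bbar))⁻¹ * sellerUtility Db s p := fun p hp => by
    unfold sellerUtility
    rw [measureReal_cond measurableSet_Ici, inter_eq_right.2 (Ici_subset_Ici.2 (h1.le.trans hp))]
    ring
  obtain ⟨p, hp, hoffer⟩ := exists_isSellerOffer hsb.le h2.le
    (measureReal_cond_Ici_pos hb hsb.le hnull) fun K hK p _ hbp => by
      rw [hu p (hsb.le.trans hbp.le), ← le_div_iff₀' hκ]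
      refine sellerUtility_le_of_le_ironedVirtualValue hDb hb hsb.le h (fun q hq => ?_) hbp
      rw [le_div_iff₀' hκ, ← hu q hq.1]
      exact hK q hq
  exact ⟨p, hoffer, hp⟩

theorem boTrades_of_ironedVirtualCost_le (hDs : Ds (Iio 0) = 0) (hs : s ∈ Ds.support)
    (hsb : s < b) (h1 : bbar < s) (h2 : (b : EReal) < sbar)
    (h : ironedVirtualCost Ds s ≤ (b : EReal)) :
    BOTrades bbar (cond Ds {x : ℝ | (x : EReal) ≤ sbar}) b s := by
  have hsub : ∀ p ≤ b, Iic p ⊆ {x : ℝ | (x : EReal) ≤ sbar} := fun p hp x hx =>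
    le_trans (EReal.coe_le_coe_iff.2 (le_trans hx hp)) h2.le
  have hnull : Ds {x : ℝ | (x : EReal) ≤ sbar} ≠ 0 := measure_ne_zero_of_mem_support hs
    (Filter.mem_of_superset (Iic_mem_nhds hsb) (hsub b le_rfl))
  have hκ : 0 < (Ds.real {x : ℝ | (x : EReal) ≤ sbar})⁻¹ :=
    inv_pos.2 (ENNReal.toReal_pos hnull (measure_ne_top _ _))
  have hu : ∀ p, p ≤ b → buyerUtility (cond Ds {x : ℝ | (x : EReal) ≤ sbar}) b p =
      (Ds.real {x : ℝ | (x : EReal) ≤ sbar})⁻¹ * buyerUtility Ds b p := fun p hp => by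
    unfold buyerUtility
    rw [measureReal_cond (measurableSet_coe_le _), inter_eq_right.2 (hsub p hp)]
    ring
  obtain ⟨p, hp, hoffer⟩ := exists_isBuyerOffer hsb.le h1.le
    (measureReal_cond_Iic_pos hs hsb.le hnull) fun K hK p _ hps => by
      rw [hu p (hps.le.trans hsb.le), ← le_div_iff₀' hκ]
      refine buyerUtility_le_of_ironedVirtualCost_le hDs hs hsb.le h (fun q hq => ?_) hps
      rw [le_div_iff₀' hκ, ← hu q hq.2]
      exact hK q hq
  exact ⟨p, hoffer, hp⟩

end Edge

/-! ### Critical bids in the first-best matching -/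

section FirstBest

variable {β σ : Type*} {E : Finset (β × σ)} {b : β → ℝ} {s : σ → ℝ}

theorem coe_gainsFromTrade (b : β → ℝ) (s : σ → ℝ) (N : Finset (β × σ)) :
    ((gainsFromTrade b s N : ℝ) : EReal) = ∑ e ∈ N, ((b e.1 - s e.2 : ℝ) : EReal) := by
  classical
  unfold gainsFromTrade
  induction N using Finset.induction_on with
  | empty => simp
  | insert e N he ih => rw [Finset.sum_insert he, Finset.sum_insert he, EReal.coe_add, ih]

theorem gainsFromTrade_update_buyer_of_forall_ne [DecidableEq β] {N : Finset (β × σ)} {i : β}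
    (y : ℝ) (hi : ∀ e ∈ N, e.1 ≠ i) :
    gainsFromTrade (Function.update b i y) s N = gainsFromTrade b s N :=
  Finset.sum_congr rfl fun e he => by rw [Function.update_of_ne (hi e he)]

theorem gainsFromTrade_update_seller_of_forall_ne [DecidableEq σ] {N : Finset (β × σ)} {j : σ}
    (x : ℝ) (hj : ∀ e ∈ N, e.2 ≠ j) :
    gainsFromTrade b (Function.update s j x) N = gainsFromTrade b s N :=
  Finset.sum_congr rfl fun e he => by rw [Function.update_of_ne (hj e he)]

theorem gainsFromTrade_update_buyer [DecidableEq β] {N : Finset (β × σ)}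
    (hN : IsMatchingIn E N) {e : β × σ} (he : e ∈ N) (y : ℝ) :
    gainsFromTrade (Function.update b e.1 y) s N = gainsFromTrade b s N + (y - b e.1) := by
  classical
  rw [← gainsFromTrade_erase_add _ s he, ← gainsFromTrade_erase_add b s he,
    gainsFromTrade_update_buyer_of_forall_ne, Function.update_self]
  · ring
  · exact fun f hf h => (Finset.mem_erase.1 hf).1 (hN.eq_of_fst (Finset.mem_of_mem_erase hf) he h)

theorem gainsFromTrade_update_seller [DecidableEq σ] {N : Finset (β × σ)}
    (hN : IsMatchingIn E N) {e : β × σ} (he : e ∈ N) (x : ℝ) :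
    gainsFromTrade b (Function.update s e.2 x) N = gainsFromTrade b s N + (s e.2 - x) := by
  classical
  rw [← gainsFromTrade_erase_add b _ he, ← gainsFromTrade_erase_add b s he,
    gainsFromTrade_update_seller_of_forall_ne, Function.update_self]
  · ring
  · exact fun f hf h => (Finset.mem_erase.1 hf).1 (hN.eq_of_snd (Finset.mem_of_mem_erase hf) he h)

theorem gainsFromTrade_le_update_buyer [DecidableEq β] (N : Finset (β × σ)) {i : β} {y : ℝ}
    (hy : b i ≤ y) :
    gainsFromTrade b s N ≤ gainsFromTrade (Function.update b i y) s N := by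
  refine Finset.sum_le_sum fun e _ => sub_le_sub_right ?_ _
  by_cases h : e.1 = i
  · rw [h, Function.update_self]
    exact hy
  · rw [Function.update_of_ne h]

theorem IsMatchingIn.of_removeBuyer [DecidableEq β] {N : Finset (β × σ)} {i : β}
    (h : IsMatchingIn (_root_.removeBuyer E i) N) : IsMatchingIn E N ∧ ∀ e ∈ N, e.1 ≠ i :=
  ⟨h.mono (Finset.filter_subset _ _), fun _ he => (Finset.mem_filter.1 (h.1 he)).2⟩

theorem IsMatchingIn.of_removeSeller [DecidableEq σ] {N : Finset (β × σ)} {j : σ}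
    (h : IsMatchingIn (_root_.removeSeller E j) N) : IsMatchingIn E N ∧ ∀ e ∈ N, e.2 ≠ j :=
  ⟨h.mono (Finset.filter_subset _ _), fun _ he => (Finset.mem_filter.1 (h.1 he)).2⟩

variable [LinearOrder β] [LinearOrder σ]

theorem isMatchingIn_firstBest : IsMatchingIn E (firstBest E b s) :=
  (chosenMatching_spec E _).1.1

theorem gainsFromTrade_le_firstBest {N : Finset (β × σ)} (hN : IsMatchingIn E N) :
    gainsFromTrade b s N ≤ gainsFromTrade b s (firstBest E b s) := by
  have h := (chosenMatching_spec E (fun e => ((b e.1 - s e.2 : ℝ) : EReal))).1.2 N hN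
  rwa [← coe_gainsFromTrade, ← coe_gainsFromTrade, EReal.coe_le_coe_iff] at h

variable {e : β × σ}

theorem forall_mem_erase_firstBest_fst_ne (he : e ∈ firstBest E b s) :
    ∀ f ∈ (firstBest E b s).erase e, f.1 ≠ e.1 := fun _ hf h =>
  (Finset.mem_erase.1 hf).1 (isMatchingIn_firstBest.eq_of_fst (Finset.mem_of_mem_erase hf) he h)

theorem forall_mem_erase_firstBest_snd_ne (he : e ∈ firstBest E b s) :
    ∀ f ∈ (firstBest E b s).erase e, f.2 ≠ e.2 := fun _ hf h =>
  (Finset.mem_erase.1 hf).1 (isMatchingIn_firstBest.eq_of_snd (Finset.mem_of_mem_erase hf) he h)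

/-- Without one of its edges `e`, the first-best matching is optimal in the market without the
buyer and the seller of `e`. -/
theorem gainsFromTrade_le_firstBest_erase (he : e ∈ firstBest E b s) {N : Finset (β × σ)}
    (hN : IsMatchingIn E N) (h1 : ∀ f ∈ N, f.1 ≠ e.1) (h2 : ∀ f ∈ N, f.2 ≠ e.2) :
    gainsFromTrade b s N ≤ gainsFromTrade b s ((firstBest E b s).erase e) := by
  have h := gainsFromTrade_le_firstBest (b := b) (s := s)
    (hN.cons (isMatchingIn_firstBest.1 he) h1 h2)
  rw [gainsFromTrade_insert b s fun h => h1 e h rfl, ← gainsFromTrade_erase_add b s he] at h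
  linarith

theorem cost_le_value_of_mem_firstBest (he : e ∈ firstBest E b s) : s e.2 ≤ b e.1 := by
  have h := gainsFromTrade_le_firstBest (b := b) (s := s)
    (isMatchingIn_firstBest.subset (Finset.erase_subset e (firstBest E b s)))
  rw [← gainsFromTrade_erase_add b s he] at h
  linarith

/-- A bid `y` with which the buyer of `e` is in the first-best without the seller of `e` gives a
lower bound for the weight of a matching that avoids this seller. -/
theorem exists_matching_of_buyer_bid (he : e ∈ firstBest E b s) {y : ℝ}
    (hy : ∃ f ∈ firstBest (removeSeller E e.2) (Function.update b e.1 y) s, f.1 = e.1) :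
    ∃ N, IsMatchingIn E N ∧ (∀ f ∈ N, f.2 ≠ e.2) ∧
      gainsFromTrade b s ((firstBest E b s).erase e) + (b e.1 - y) ≤ gainsFromTrade b s N := by
  obtain ⟨f, hf, hfe⟩ := hy
  have hN := (isMatchingIn_firstBest (E := removeSeller E e.2) (b := Function.update b e.1 y)
    (s := s)).of_removeSeller
  refine ⟨_, hN.1, hN.2, ?_⟩
  have h := gainsFromTrade_le_firstBest (b := Function.update b e.1 y) (s := s)
    ((isMatchingIn_firstBest.subset (Finset.erase_subset e (firstBest E b s))).removeSeller
      (forall_mem_erase_firstBest_snd_ne he))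
  rw [gainsFromTrade_update_buyer_of_forall_ne y (forall_mem_erase_firstBest_fst_ne he)] at h
  have h2 := gainsFromTrade_update_buyer (b := b) (s := s) hN.1 hf y
  rw [hfe] at h2
  linarith

/-- A bid `x` with which the seller of `e` is in the first-best without the buyer of `e` gives a
lower bound for the weight of a matching that avoids this buyer. -/
theorem exists_matching_of_seller_bid (he : e ∈ firstBest E b s) {x : ℝ}
    (hx : ∃ f ∈ firstBest (removeBuyer E e.1) b (Function.update s e.2 x), f.2 = e.2) :
    ∃ N, IsMatchingIn E N ∧ (∀ f ∈ N, f.1 ≠ e.1) ∧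
      gainsFromTrade b s ((firstBest E b s).erase e) + (x - s e.2) ≤ gainsFromTrade b s N := by
  obtain ⟨f, hf, hfe⟩ := hx
  have hN := (isMatchingIn_firstBest (E := removeBuyer E e.1) (b := b)
    (s := Function.update s e.2 x)).of_removeBuyer
  refine ⟨_, hN.1, hN.2, ?_⟩
  have h := gainsFromTrade_le_firstBest (b := b) (s := Function.update s e.2 x)
    ((isMatchingIn_firstBest.subset (Finset.erase_subset e (firstBest E b s))).removeBuyer
      (forall_mem_erase_firstBest_fst_ne he))
  rw [gainsFromTrade_update_seller_of_forall_ne x (forall_mem_erase_firstBest_snd_ne he)] at h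
  have h2 := gainsFromTrade_update_seller (b := b) (s := s) hN.1 hf x
  rw [hfe] at h2
  linarith

theorem seller_bid_le (he : e ∈ firstBest E b s) {x : ℝ}
    (hx : ∃ f ∈ firstBest (removeBuyer E e.1) b (Function.update s e.2 x), f.2 = e.2) :
    x ≤ b e.1 := by
  obtain ⟨N, hN, -, hle⟩ := exists_matching_of_seller_bid he hx
  have h := gainsFromTrade_le_firstBest (b := b) (s := s) hN
  rw [← gainsFromTrade_erase_add b s he] at h
  linarith

/-- The hypothesis `0 ≤ b e.1` is for the case that no bid wins, where `bBar` is `0`. -/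
theorem bBar_le (he : e ∈ firstBest E b s) (hb : 0 ≤ b e.1) : bBar E b s e.1 e.2 ≤ b e.1 :=
  Real.sSup_le (fun _ hx => seller_bid_le he hx.2) hb

theorem le_sBar (he : e ∈ firstBest E b s) : (s e.2 : EReal) ≤ sBar E b s e.1 e.2 := by
  refine le_sInf ?_
  rintro _ ⟨x, ⟨-, hx⟩, rfl⟩
  refine EReal.coe_le_coe_iff.2 (le_of_forall_gt_imp_ge_of_dense fun y hy => ?_)
  obtain ⟨N, hN, -, hle⟩ := exists_matching_of_buyer_bid he (hx y hy)
  have h := gainsFromTrade_le_firstBest (b := b) (s := s) hN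
  rw [← gainsFromTrade_erase_add b s he] at h
  linarith

theorem bBar_le_sBar (he : e ∈ firstBest E b s) :
    (bBar E b s e.1 e.2 : EReal) ≤ sBar E b s e.1 e.2 := by
  refine le_sInf ?_
  rintro _ ⟨x, ⟨hx0, hx⟩, rfl⟩
  refine EReal.coe_le_coe_iff.2 (Real.sSup_le (fun z hz => ?_) hx0)
  refine le_of_forall_gt_imp_ge_of_dense fun y hy => ?_
  obtain ⟨N₁, h₁, hj, hle₁⟩ := exists_matching_of_buyer_bid he (hx y hy)
  obtain ⟨N₂, h₂, hi, hle₂⟩ := exists_matching_of_seller_bid he hz.2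
  have h := gainsFromTrade_add_le_of_complements h₁ h₂ hj hi
    (fun N hN => gainsFromTrade_le_firstBest (b := b) (s := s) hN)
    (fun N hN h1 h2 => gainsFromTrade_le_firstBest_erase he hN h1 h2)
  rw [← gainsFromTrade_erase_add b s he] at h
  linarith

/-- If the constraint `bBar` is below the cost of the seller of `e`, she is not in the first-best
of the market without the buyer of `e`, so this market is as good as the one without both. -/
theorem gainsFromTrade_le_of_bBar_lt (he : e ∈ firstBest E b s) (hs : 0 ≤ s e.2)
    (h : bBar E b s e.1 e.2 < s e.2) {N : Finset (β × σ)}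
    (hN : IsMatchingIn (removeBuyer E e.1) N) :
    gainsFromTrade b s N ≤ gainsFromTrade b s ((firstBest E b s).erase e) := by
  have hout : ∀ f ∈ firstBest (removeBuyer E e.1) b s, f.2 ≠ e.2 := by
    intro f hf hfe
    refine not_le.2 h (le_csSup ⟨b e.1, fun x hx => seller_bid_le he hx.2⟩ ⟨hs, f, ?_, hfe⟩)
    rwa [Function.update_eq_self]
  have hF := (isMatchingIn_firstBest (E := removeBuyer E e.1) (b := b) (s := s)).of_removeBuyer
  exact (gainsFromTrade_le_firstBest hN).trans
    (gainsFromTrade_le_firstBest_erase he hF.1 hF.2 hout)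

/-- If the constraint `sBar` is above the value of the buyer of `e`, some bid above
her value does not put her in the first-best of the market without the seller of `e`, so this
market is as good as the one without both. -/
theorem gainsFromTrade_le_of_lt_sBar (he : e ∈ firstBest E b s) (hb : 0 ≤ b e.1)
    (h : (b e.1 : EReal) < sBar E b s e.1 e.2) {N : Finset (β × σ)}
    (hN : IsMatchingIn (removeSeller E e.2) N) :
    gainsFromTrade b s N ≤ gainsFromTrade b s ((firstBest E b s).erase e) := by
  obtain ⟨y, hy, hout⟩ : ∃ y, b e.1 < y ∧
      ∀ f ∈ firstBest (removeSeller E e.2) (Function.update b e.1 y) s, f.1 ≠ e.1 := by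
    by_contra! hcon
    exact not_le.2 h (sInf_le ⟨b e.1, ⟨hb, hcon⟩, rfl⟩)
  have hF := (isMatchingIn_firstBest (E := removeSeller E e.2) (b := Function.update b e.1 y)
    (s := s)).of_removeSeller
  calc gainsFromTrade b s N ≤ gainsFromTrade (Function.update b e.1 y) s N :=
        gainsFromTrade_le_update_buyer N hy.le
    _ ≤ _ := gainsFromTrade_le_firstBest hN
    _ = _ := gainsFromTrade_update_buyer_of_forall_ne y hout
    _ ≤ _ := gainsFromTrade_le_firstBest_erase he hF.1 hout hF.2

end FirstBest

/-! ### Comparison with virtual welfare maximization -/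

section VirtualWelfare

variable {β σ : Type*}

theorem ne_bot_of_sum_nonneg {ι : Type*} {N : Finset ι} {w : ι → EReal} (h : 0 ≤ ∑ e ∈ N, w e)
    {e : ι} (he : e ∈ N) : w e ≠ ⊥ := by
  classical
  intro hbot
  rw [← Finset.add_sum_erase N w he, hbot, EReal.bot_add] at h
  exact absurd h (by simp)

/-- A matching `V` that maximizes the sum of the virtual weights `α - γ`, where one of `α`, `γ` is
the true value or cost, gains no more from trade than the first-best `M` does on the edges outside
`D`, if `M` without any edge of `D` stays optimal when one of the end points of the edge leaves
the market, and the edges of `D` have negative virtual weight. -/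
theorem gainsFromTrade_virtual_le [Finite β] [LinearOrder β] [Finite σ] [LinearOrder σ]
    {E D V : Finset (β × σ)} {b : β → ℝ} {s : σ → ℝ} {α : β → EReal} {γ : σ → EReal}
    (hα : ∀ i, α i ≠ ⊤) (hγ : ∀ j, γ j ≠ ⊥)
    (hor : (∀ j, γ j = s j) ∨ ∀ i, α i = b i)
    (hV : IsChosenMatching E (fun e => α e.1 - γ e.2) V) (hDM : D ⊆ firstBest E b s)
    (hDb : ∀ e ∈ D, ∀ N, IsMatchingIn (removeBuyer E e.1) N →
      gainsFromTrade b s N ≤ gainsFromTrade b s ((firstBest E b s).erase e))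
    (hDs : ∀ e ∈ D, ∀ N, IsMatchingIn (removeSeller E e.2) N →
      gainsFromTrade b s N ≤ gainsFromTrade b s ((firstBest E b s).erase e))
    (hD : ∀ e ∈ D, α e.1 < γ e.2) :
    gainsFromTrade b s V ≤ gainsFromTrade b s (firstBest E b s \ D) := by
  have h0 : 0 ≤ ∑ e ∈ V, (α e.1 - γ e.2) := by
    simpa using hV.1.2 ∅ ⟨by simp, by simp⟩
  -- The virtual values and costs of the vertices that `V` uses are finite.
  have hfst : ∀ {i}, (∃ g ∈ V, g.1 = i) → ((α i).toReal : EReal) = α i := by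
    rintro _ ⟨g, hg, rfl⟩
    refine EReal.coe_toReal (hα _) fun hbot => ne_bot_of_sum_nonneg h0 hg ?_
    rw [hbot, sub_eq_add_neg, EReal.bot_add]
  have hsnd : ∀ {j}, (∃ g ∈ V, g.2 = j) → ((γ j).toReal : EReal) = γ j := by
    rintro _ ⟨g, hg, rfl⟩
    refine EReal.coe_toReal (fun htop => ne_bot_of_sum_nonneg h0 hg ?_) (hγ _)
    rw [htop, sub_eq_add_neg, EReal.neg_top, EReal.add_bot]
  have hsum : ∀ N : Finset (β × σ), (∀ f ∈ N, (∃ g ∈ V, g.1 = f.1) ∧ ∃ g ∈ V, g.2 = f.2) →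
      ∑ e ∈ N, (α e.1 - γ e.2) =
        ((gainsFromTrade (fun i => (α i).toReal) (fun j => (γ j).toReal) N : ℝ) : EReal) := by
    intro N hN
    rw [coe_gainsFromTrade]
    refine Finset.sum_congr rfl fun f hf => ?_
    rw [EReal.coe_sub, hfst (hN f hf).1, hsnd (hN f hf).2]
  refine gainsFromTrade_le_sdiff (a := fun i => (α i).toReal) (c := fun j => (γ j).toReal)
    isMatchingIn_firstBest (fun N hN => gainsFromTrade_le_firstBest hN) hDM hDb hDs hV.1.1
    (fun N hN hNV => ?_) (fun e he h1 h2 => ?_) (fun e he e' he' _ h1 h2 hca hs hb => ?_)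
  · have h := hV.1.2 N hN
    rwa [hsum N hNV, hsum V fun f hf => ⟨⟨f, hf, rfl⟩, f, hf, rfl⟩, EReal.coe_le_coe_iff] at h
  · rw [← EReal.coe_lt_coe_iff, hfst h1, hsnd h2]
    exact hD e he
  · rcases hor with hor | hor
    · have h3 := hD e he
      rw [← hfst h1, hor, EReal.coe_lt_coe_iff] at h3
      simp only [hor, EReal.toReal_coe] at hca
      linarith
    · have h3 := hD e' he'
      rw [← hsnd h2, hor, EReal.coe_lt_coe_iff] at h3
      simp only [hor, EReal.toReal_coe] at hca
      linarith

theorem nonneg_of_mem_support {D : Measure ℝ} (hD : D (Set.Iio 0) = 0) {x : ℝ}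
    (hx : x ∈ D.support) : 0 ≤ x := by
  by_contra! h
  exact measure_ne_zero_of_mem_support hx (Iio_mem_nhds h) hD

theorem roGFT_nonneg {sbar : EReal} {Db Ds : Measure ℝ} {bbar b s : ℝ} (h : s ≤ b) :
    0 ≤ roGFT sbar Db bbar Ds b s := by
  unfold roGFT
  have := sub_nonneg.2 h
  split_ifs <;> linarith

theorem half_le_roGFT {sbar : EReal} {Db Ds : Measure ℝ} {bbar b s : ℝ} (h : s ≤ b)
    (ht : SOTrades sbar Db b s ∨ BOTrades bbar Ds b s) :
    (1 / 2) * (b - s) ≤ roGFT sbar Db bbar Ds b s := by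
  unfold roGFT
  have := sub_nonneg.2 h
  rcases ht with ht | ht
  · rw [if_pos ht]
    split_ifs <;> linarith
  · rw [if_pos ht]
    split_ifs <;> linarith

end VirtualWelfare

theorem mainTheorem4 {β σ : Type*} [Fintype β] [LinearOrder β] [Fintype σ] [LinearOrder σ]
    (E : Finset (β × σ))
    (DB : β → Measure ℝ) [∀ i, IsProbabilityMeasure (DB i)]
    (DS : σ → Measure ℝ) [∀ j, IsProbabilityMeasure (DS j)]
    (hDB : ∀ i, DB i (Set.Iio 0) = 0) (hDS : ∀ j, DS j (Set.Iio 0) = 0)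
    (b : β → ℝ) (s : σ → ℝ)
    (hb : ∀ i, b i ∈ (DB i).support) (hs : ∀ j, s j ∈ (DS j).support) :
    (1 / 2) * rvwmGFT E DB DS b s ≤ offeringGFT E DB DS b s := by
  classical
  have hb0 : ∀ i, 0 ≤ b i := fun i => nonneg_of_mem_support (hDB i) (hb i)
  have hs0 : ∀ j, 0 ≤ s j := fun j => nonneg_of_mem_support (hDS j) (hs j)
  set M := firstBest E b s with hM
  -- The first-best edges with positive gains on which neither offer leads to trade.
  set D := M.filter fun e => s e.2 < b e.1 ∧
    ¬ (SOTrades (sBar E b s e.1 e.2)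
        (cond (DB e.1) (Set.Ici (bBar E b s e.1 e.2))) (b e.1) (s e.2) ∨
      BOTrades (bBar E b s e.1 e.2)
        (cond (DS e.2) {x : ℝ | (x : EReal) ≤ sBar E b s e.1 e.2}) (b e.1) (s e.2)) with hD
  have hDM : D ⊆ M := Finset.filter_subset _ _
  have hDlt : ∀ e ∈ D, bBar E b s e.1 e.2 < s e.2 ∧ (b e.1 : EReal) < sBar E b s e.1 e.2 := by
    intro e he
    obtain ⟨heM, hlt, hno⟩ := Finset.mem_filter.1 he
    have h := mt (trades_of_constraint (hb e.1) (hs e.2) hlt (bBar_le heM (hb0 _)) (le_sBar heM)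
      (bBar_le_sBar heM)) hno
    rw [not_or, not_le, not_le] at h
    exact ⟨h.2, h.1⟩
  have hDb : ∀ e ∈ D, ∀ N, IsMatchingIn (removeBuyer E e.1) N →
      gainsFromTrade b s N ≤ gainsFromTrade b s (M.erase e) := fun e he N hN =>
    gainsFromTrade_le_of_bBar_lt (hDM he) (hs0 _) (hDlt e he).1 hN
  have hDs : ∀ e ∈ D, ∀ N, IsMatchingIn (removeSeller E e.2) N →
      gainsFromTrade b s N ≤ gainsFromTrade b s (M.erase e) := fun e he N hN =>
    gainsFromTrade_le_of_lt_sBar (hDM he) (hb0 _) (hDlt e he).2 hN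
  have hgsom : gainsFromTrade b s (gsomMatching E DB b s) ≤ gainsFromTrade b s (M \ D) := by
    refine gainsFromTrade_virtual_le (α := fun i => ironedVirtualValue (DB i) (b i))
      (γ := fun j => (s j : EReal)) (fun _ => ironedVirtualValue_ne_top _ _)
      (fun _ => EReal.coe_ne_bot _) (Or.inl fun _ => rfl) (chosenMatching_spec _ _) hDM hDb hDs
      fun e he => ?_
    obtain ⟨heM, hlt, hno⟩ := Finset.mem_filter.1 he
    by_contra! hle
    exact hno (Or.inl (soTrades_of_le_ironedVirtualValue (hDB _) (hb _) hlt (hDlt e he).1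
      (hDlt e he).2 hle))
  have hgbom : gainsFromTrade b s (gbomMatching E DS b s) ≤ gainsFromTrade b s (M \ D) := by
    refine gainsFromTrade_virtual_le (α := fun i => (b i : EReal))
      (γ := fun j => ironedVirtualCost (DS j) (s j)) (fun _ => EReal.coe_ne_top _)
      (fun _ => ironedVirtualCost_ne_bot _ _) (Or.inr fun _ => rfl) (chosenMatching_spec _ _)
      hDM hDb hDs fun e he => ?_
    obtain ⟨heM, hlt, hno⟩ := Finset.mem_filter.1 he
    by_contra! hle
    exact hno (Or.inr (boTrades_of_ironedVirtualCost_le (hDS _) (hs _) hlt (hDlt e he).1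
      (hDlt e he).2 hle))
  have hoffer : (1 / 2) * gainsFromTrade b s (M \ D) ≤ offeringGFT E DB DS b s := by
    unfold offeringGFT gainsFromTrade
    rw [Finset.mul_sum, ← hM]
    refine (Finset.sum_le_sum fun e he => ?_).trans (Finset.sum_le_sum_of_subset_of_nonneg
      (Finset.sdiff_subset (s := M) (t := D)) fun e he _ =>
        roGFT_nonneg (cost_le_value_of_mem_firstBest he))
    obtain ⟨heM, heD⟩ := Finset.mem_sdiff.1 he
    have hle := cost_le_value_of_mem_firstBest heM
    rcases hle.eq_or_lt with heq | hlt
    · rw [heq, sub_self, mul_zero]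
      exact roGFT_nonneg le_rfl
    · refine half_le_roGFT hle ?_
      by_contra hno
      exact heD (Finset.mem_filter.2 ⟨heM, hlt, hno⟩)
  unfold rvwmGFT
  linarith
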